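/- Let $M$ be a smooth three-manifold with a strictly pseudoconvex CR structure $(H,J)$: $H\subset TM$ is a smooth plane field, $J\colon H\to H$ is a smooth complex structure on it, $T^{1,0}$ is the $i$-eigenbundle of $J$ and $T^{0,1}$ its conjugate. A \emph{contact form} on $(M,J)$ is a smooth real one-form $\theta$ on $M$ with $\ker\theta=H$ such that $d\theta(\cdot,J\cdot)$ is positive definite on $H$. Its \emph{Reeb field} $T$ is given by $\theta(T)=1$, $d\theta(T,\cdot)=0$. Given a contact form $\theta$, let $\theta^1$ be a local $(1,0)$-form (i.e. $\theta^1$ annihilates $T^{0,1}$) that is nonzero on $T^{1,0}$ and satisfies $\theta^1(T)=0$, put $\theta^{\bar 1}=\overline{\theta^1}$, and let $\{T,Z_1,Z_{\bar 1}\}$ be the frame dual to $\{\theta,\theta^1,\theta^{\bar 1}\}$. The Levi form $h_{1\bar 1}>0$, the connection form $\omega_1{}^1$, the torsion $A_{11}$ and the scalar curvature $R$ are determined by \[ d\theta = i h_{1\bar 1}\,\theta^1\wedge\theta^{\bar 1},\qquad d\theta^1=\theta^1\wedge\omega_1{}^1+h_{1\bar 1}^{-1}\overline{A_{11}}\,\theta\wedge\theta^{\bar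 1},\qquad h_{1\bar 1}\bigl(\omega_1{}^1+\overline{\omega_1{}^1}\bigr)=dh_{1\bar 1}, \] \[ d\omega_1{}^1\equiv R\,h_{1\bar 1}\,\theta^1\wedge\theta^{\bar 1}\pmod\theta . \] The contact form $\theta$ is \emph{pseudo-Einstein} if for every such local coframe \[ W_1:=\nabla_1R-i\nabla^1A_{11}=Z_1R-i\,h_{1\bar 1}^{-1}\bigl(Z_{\bar 1}A_{11}-2\,\omega_1{}^1(Z_{\bar 1})A_{11}\bigr)=0 . \] A function $u\in C^\infty(M;\mathbb{R})$ is \emph{CR pluriharmonic} if near every point it is the real part of a smooth complex function $v$ with $\bar Zv=0$ for all $\bar Z\in T^{0,1}$. \textbf{Proposition.} Let $\theta$ be a pseudo-Einstein contact form on $(M,J)$. Then the set of all pseudo-Einstein contact forms on $(M,J)$ is \[ \{\, e^u\theta \;:\; u \text{ is a CR pluriharmonic function on } M \,\}. \] -/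

import Mathlib

open scoped Manifold ContDiff ComplexConjugate

noncomputable section

/-! ### One-forms on a smooth three-manifold -/

section Forms

variable {M : Type*} [TopologicalSpace M] [ChartedSpace (EuclideanSpace ℝ (Fin 3)) M]
  {F : Type*} [NormedAddCommGroup F] [NormedSpace ℝ F]

/-- (Not necessarily smooth) `F`-valued one-forms on the three-manifold `M`; `F` is `ℝ` or `ℂ`. -/
abbrev OneForm (M : Type*) [TopologicalSpace M] [ChartedSpace (EuclideanSpace ℝ (Fin 3)) M]
    (F : Type*) [NormedAddCommGroup F] [NormedSpace ℝ F] : Type _ :=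
  (p : M) → TangentSpace (𝓡 3) p →L[ℝ] F

/-- The representation of a one-form in the preferred chart at `p`, i.e. its pullback under the
inverse of that chart. -/
def OneForm.inChart (α : OneForm M F) (p : M) :
    EuclideanSpace ℝ (Fin 3) → EuclideanSpace ℝ (Fin 3) →L[ℝ] F :=
  fun y => (α ((extChartAt (𝓡 3) p).symm y)).comp
    (mfderiv 𝓘(ℝ, EuclideanSpace ℝ (Fin 3)) (𝓡 3) (extChartAt (𝓡 3) p).symm y)

/-- The one-form `α` is smooth on the (open) set `U`: its coordinate representations are smooth. -/
def OneForm.SmoothOn (α : OneForm M F) (U : Set M) : Prop :=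
  ∀ p ∈ U, ContDiffAt ℝ ∞ (α.inChart p) (extChartAt (𝓡 3) p p)

/-- The exterior derivative `dα(v, w)` at `p`, computed in the preferred chart at `p`. -/
def OneForm.d (α : OneForm M F) (p : M) (v w : TangentSpace (𝓡 3) p) : F :=
  let φ : TangentSpace (𝓡 3) p →L[ℝ] EuclideanSpace ℝ (Fin 3) :=
    mfderiv (𝓡 3) 𝓘(ℝ, EuclideanSpace ℝ (Fin 3)) (extChartAt (𝓡 3) p) p
  let Dα := fderiv ℝ (α.inChart p) (extChartAt (𝓡 3) p p)
  Dα (φ v) (φ w) - Dα (φ w) (φ v)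

/-- The wedge product `(α ∧ β)(v, w) = α(v) β(w) - α(w) β(v)` of complex one-forms at a point. -/
def OneForm.wedge (α β : OneForm M ℂ) (p : M) (v w : TangentSpace (𝓡 3) p) : ℂ :=
  α p v * β p w - α p w * β p v

/-- The complex conjugate of a complex one-form. -/
def OneForm.bar (α : OneForm M ℂ) : OneForm M ℂ :=
  fun p => (Complex.conjCLE : ℂ →L[ℝ] ℂ).comp (α p)

/-- A real one-form, regarded as a complex one. -/
def OneForm.toComplex (α : OneForm M ℝ) : OneForm M ℂ :=
  fun p => Complex.ofRealCLM.comp (α p)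

/-- The differential of a function, as a one-form. -/
def oneFormOf (f : M → F) : OneForm M F :=
  fun p => (mfderiv (𝓡 3) 𝓘(ℝ, F) f p : TangentSpace (𝓡 3) p →L[ℝ] F)

end Forms

/-! ### CR structures -/

/-- A smooth plane field `H ⊆ TM` on the three-manifold `M` with a smooth complex structure
`J : H → H`. Since `T^{1,0}`, the `i`-eigenbundle of `J`, has complex rank one, formal
integrability (`[Γ(T^{1,0}), Γ(T^{1,0})] ⊆ Γ(T^{1,0})`) is automatic. Nonintegrability of `H` and
strict pseudoconvexity are expressed by the existence of a contact form in the sense of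
`CRStructure.IsContactForm`. -/
structure CRStructure (M : Type*) [TopologicalSpace M]
    [ChartedSpace (EuclideanSpace ℝ (Fin 3)) M] [IsManifold (𝓡 3) ∞ M] where
  /-- the plane field -/
  H : (p : M) → Submodule ℝ (TangentSpace (𝓡 3) p)
  /-- the complex structure on the plane field -/
  J : (p : M) → H p →ₗ[ℝ] H p
  finrank_H : ∀ p, Module.finrank ℝ (H p) = 2
  J_sq : ∀ p (v : H p), J p (J p v) = -v
  /-- Smoothness: near every point there is a nowhere zero section `X` of `H` such that `X` and
  `J X` are smooth vector fields (so that `X, J X` is a smooth local frame of `H`). -/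
  smooth : ∀ p : M, ∃ U : Set M, IsOpen U ∧ p ∈ U ∧ ∃ X : (q : M) → H q,
    (∀ q ∈ U, X q ≠ 0) ∧
    ContMDiffOn (𝓡 3) (𝓡 3).tangent ∞
      (fun q => (⟨q, (X q : TangentSpace (𝓡 3) q)⟩ : TangentBundle (𝓡 3) M)) U ∧
    ContMDiffOn (𝓡 3) (𝓡 3).tangent ∞
      (fun q => (⟨q, (J q (X q) : TangentSpace (𝓡 3) q)⟩ : TangentBundle (𝓡 3) M)) U

namespace CRStructure

variable {M : Type*} [TopologicalSpace M] [ChartedSpace (EuclideanSpace ℝ (Fin 3)) M]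
  [IsManifold (𝓡 3) ∞ M]

/-- `θ` is a (positive) contact form for the strictly pseudoconvex CR structure `S`: a smooth real
one-form with kernel `H` such that `dθ(·, J ·)` is positive definite on `H`. -/
structure IsContactForm (S : CRStructure M) (θ : OneForm M ℝ) : Prop where
  smooth : θ.SmoothOn Set.univ
  ker_eq : ∀ p (v : TangentSpace (𝓡 3) p), v ∈ S.H p ↔ θ p v = 0
  pos : ∀ p (v : S.H p), v ≠ 0 → 0 < θ.d p v (S.J p v)

/-- `v` is the value at `p` of the Reeb vector field `T` of `θ`: `θ(T) = 1` and `dθ(T, ·) = 0`. -/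
def IsReebAt (θ : OneForm M ℝ) (p : M) (v : TangentSpace (𝓡 3) p) : Prop :=
  θ p v = 1 ∧ ∀ w, θ.d p v w = 0

/-- For `X ∈ H` put `Z = (X - i J X) / 2 ∈ T^{1,0}`. This is the value on `Z` of the complex-linear
extension of the complex one-form `η`. -/
def evalZ (S : CRStructure M) (η : OneForm M ℂ) (p : M) (X : S.H p) : ℂ :=
  (η p X - Complex.I * η p (S.J p X)) / 2

/-- For `X ∈ H` put `Z = (X - i J X) / 2 ∈ T^{1,0}`. This is the value on the conjugate vector
`(X + i J X) / 2 ∈ T^{0,1}` of the complex-linear extension of the complex one-form `η`. -/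
def evalZbar (S : CRStructure M) (η : OneForm M ℂ) (p : M) (X : S.H p) : ℂ :=
  (η p X + Complex.I * η p (S.J p X)) / 2

/-- An admissible coframe `{θ, θ¹, θ¹̄}` for `θ` on an open set `U`, with the components with
respect to it of the Levi form, the Tanaka-Webster connection, the torsion and the scalar
curvature. The coframe determines all the other data on `U`. -/
structure AdmissibleCoframe (S : CRStructure M) (θ : OneForm M ℝ) where
  /-- the domain of the coframe -/
  U : Set M
  isOpen_U : IsOpen U
  /-- the form `θ¹` -/
  θ₁ : OneForm M ℂ
  θ₁_smooth : θ₁.SmoothOn U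
  /-- `θ¹` is a `(1,0)`-form, i.e. it annihilates `T^{0,1}` -/
  θ₁_type : ∀ p ∈ U, ∀ v : S.H p, S.evalZbar θ₁ p v = 0
  /-- `θ¹(T) = 0` for the Reeb field `T` -/
  θ₁_reeb : ∀ p ∈ U, ∀ v, IsReebAt θ p v → θ₁ p v = 0
  /-- the vector field `X` with `Z₁ = (X - i J X) / 2`, where `{T, Z₁, Z₁̄}` is the frame dual
  to the coframe -/
  X : (p : M) → S.H p
  /-- `θ¹(Z₁) = 1`; in particular `θ¹` does not vanish on `T^{1,0}` -/
  θ₁_Z : ∀ p ∈ U, S.evalZ θ₁ p (X p) = 1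
  /-- the component `h₁₁̄` of the Levi form -/
  h : M → ℝ
  h_smooth : ContMDiffOn (𝓡 3) 𝓘(ℝ, ℝ) ∞ h U
  /-- `dθ = i h₁₁̄ θ¹ ∧ θ¹̄` -/
  dθ_eq : ∀ p ∈ U, ∀ v w, (θ.d p v w : ℂ) = Complex.I * h p * θ₁.wedge θ₁.bar p v w
  /-- the connection form `ω₁¹` -/
  conn : OneForm M ℂ
  conn_smooth : conn.SmoothOn U
  /-- the component `A₁₁` of the torsion, `τ₁ = A₁₁ θ¹` -/
  A : M → ℂ
  A_smooth : ContMDiffOn (𝓡 3) 𝓘(ℝ, ℂ) ∞ A U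
  /-- `dθ¹ = θ¹ ∧ ω₁¹ + θ ∧ τ¹` with `τ¹ = h^{11̄} conj(A₁₁) θ¹̄` -/
  dθ₁_eq : ∀ p ∈ U, ∀ v w,
    θ₁.d p v w = θ₁.wedge conn p v w
      + (h p : ℂ)⁻¹ * conj (A p) * θ.toComplex.wedge θ₁.bar p v w
  /-- `ω₁₁̄ + ω₁̄₁ = dh₁₁̄` with `ω₁₁̄ = h₁₁̄ ω₁¹` -/
  dh_eq : ∀ p ∈ U, ∀ v, (h p : ℂ) * conn p v + h p * conj (conn p v) = (oneFormOf h p v : ℂ)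
  /-- the scalar curvature -/
  R : M → ℝ
  R_smooth : ContMDiffOn (𝓡 3) 𝓘(ℝ, ℝ) ∞ R U
  /-- `dω₁¹ = R h₁₁̄ θ¹ ∧ θ¹̄` modulo `θ`, i.e. on `H = ker θ`
  (in dimension three `ω₁¹ ∧ ω₁¹ = 0` and `R₁₁̄ = R h₁₁̄`) -/
  dconn_eq : ∀ p ∈ U, ∀ v w : S.H p, conn.d p v w = R p * h p * θ₁.wedge θ₁.bar p v w

/-- The covariant derivative `∇A₁₁ = dA₁₁ - 2 A₁₁ ω₁¹` of the torsion. -/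
def AdmissibleCoframe.covA {S : CRStructure M} {θ : OneForm M ℝ} (C : S.AdmissibleCoframe θ) :
    OneForm M ℂ :=
  fun p => oneFormOf C.A p - (2 * C.A p) • C.conn p

/-- The component `W₁ = ∇₁ R - i ∇¹ A₁₁`, where `∇¹ = h^{11̄} ∇₁̄`. -/
def AdmissibleCoframe.W {S : CRStructure M} {θ : OneForm M ℝ} (C : S.AdmissibleCoframe θ)
    (p : M) : ℂ :=
  S.evalZ (oneFormOf C.R).toComplex p (C.X p)
    - Complex.I * ((C.h p : ℂ)⁻¹ * S.evalZbar C.covA p (C.X p))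

/-- `θ` is a pseudo-Einstein contact form: `∇_α R - i ∇^β A_{αβ} = 0`, i.e. the component `W₁`
vanishes for every local admissible coframe. -/
def IsPseudoEinstein (S : CRStructure M) (θ : OneForm M ℝ) : Prop :=
  S.IsContactForm θ ∧ ∀ C : S.AdmissibleCoframe θ, ∀ p ∈ C.U, C.W p = 0

/-- `f` is a (smooth) CR function on the open set `U`: `Z̄ f = 0` for all `Z̄` in `T^{0,1}`. -/
def IsCRFunctionOn (S : CRStructure M) (f : M → ℂ) (U : Set M) : Prop :=
  ContMDiffOn (𝓡 3) 𝓘(ℝ, ℂ) ∞ f U ∧ ∀ p ∈ U, ∀ v : S.H p, S.evalZbar (oneFormOf f) p v = 0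

/-- `u` is a CR pluriharmonic function: smooth and locally the real part of a CR function. -/
def IsCRPluriharmonic (S : CRStructure M) (u : M → ℝ) : Prop :=
  ContMDiff (𝓡 3) 𝓘(ℝ, ℝ) ∞ u ∧
    ∀ p : M, ∃ U : Set M, IsOpen U ∧ p ∈ U ∧
      ∃ f : M → ℂ, S.IsCRFunctionOn f U ∧ ∀ q ∈ U, u q = (f q).re

end CRStructure

end

/-! The proof rests on the form η = ω₁¹ + iRθ (`eta`). Its differential vanishes on H by the
definition of R, and is purely imaginary because ω₁¹ + conj ω₁¹ = d log h. What remains is the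
component dη(Z₁, T), and d(dθ¹) = 0 identifies it with iW₁. Hence W₁ = 0 on an open set if and only
if η is closed there (`compW_eq_zero_iff`).

Any two contact forms are related by θ' = e^u θ, by positivity of the Levi forms. For coframes with
θ¹' = fθ¹ + kθ, the restriction of η' - η + d log f - du/2 to H is -(3i/2) du∘J (`conn_transform`).
So ζ = (2i/3)(η' - η + d log f - du/2) extends du∘J from H, and dζ = (2i/3)(dη' - dη)
(`exists_conjugateForm`).

If both forms are pseudo-Einstein, then ζ is closed. The Poincaré lemma gives a local g with dg =
-Re ζ, and u + ig is CR (`IsConjugateForm.exists_isCR`). Conversely, let u = Re F with F a CR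
function. Then ζ + d(Im F) vanishes on H, so it equals μθ. Since dζ vanishes on H and dθ does not, μ
= 0, so ζ is exact and dη' = dη = 0 (`IsConjugateForm.closed_of_isCR`).

All of this is done on open subsets of a normed space, with a smooth frame X, Y = JX of H, and then
carried to M through charts. Local existence of coframes is part of the proof: the pseudo-Einstein
condition quantifies over coframes and says nothing without one. -/

noncomputable section

/-! ### Exterior calculus of one-forms on a normed space. -/

namespace LocalForm

open Filter Topology

variable {E F G : Type*} [NormedAddCommGroup E] [NormedSpace ℝ E]
  [NormedAddCommGroup F] [NormedSpace ℝ F] [NormedAddCommGroup G] [NormedSpace ℝ G]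

/-- The exterior derivative of a one-form on a normed space. -/
def extD (α : E → E →L[ℝ] F) (x v w : E) : F := fderiv ℝ α x v w - fderiv ℝ α x w v

/-- The wedge product of two one-forms with values in a ring. -/
def wedge {A : Type*} [NormedRing A] [NormedSpace ℝ A] (α β : E → E →L[ℝ] A) (x v w : E) : A :=
  α x v * β x w - α x w * β x v

/-- Complex conjugate of a complex one-form. -/
def bar (α : E → E →L[ℝ] ℂ) : E → E →L[ℝ] ℂ := fun x => (Complex.conjCLE : ℂ →L[ℝ] ℂ).comp (α x)

/-- A real one-form as a complex one. -/
def toC (α : E → E →L[ℝ] ℝ) : E → E →L[ℝ] ℂ := fun x => Complex.ofRealCLM.comp (α x)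

@[simp] lemma bar_apply (α : E → E →L[ℝ] ℂ) (x v : E) : bar α x v = conj (α x v) := rfl

@[simp] lemma toC_apply (α : E → E →L[ℝ] ℝ) (x v : E) : toC α x v = (α x v : ℂ) := rfl

lemma extD_swap (α : E → E →L[ℝ] F) (x v w : E) : extD α x w v = - extD α x v w := by
  simp [extD]

@[simp] lemma extD_self (α : E → E →L[ℝ] F) (x v : E) : extD α x v v = 0 := by
  simp [extD]

lemma extD_add_left (α : E → E →L[ℝ] F) (x v v' w : E) :
    extD α x (v + v') w = extD α x v w + extD α x v' w := by
  simp [extD]; abel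

lemma extD_smul_left (α : E → E →L[ℝ] F) (x : E) (a : ℝ) (v w : E) :
    extD α x (a • v) w = a • extD α x v w := by
  simp [extD, smul_sub]

lemma extD_add_right (α : E → E →L[ℝ] F) (x v w w' : E) :
    extD α x v (w + w') = extD α x v w + extD α x v w' := by
  simp [extD]; abel

lemma extD_smul_right (α : E → E →L[ℝ] F) (x : E) (a : ℝ) (v w : E) :
    extD α x v (a • w) = a • extD α x v w := by
  simp [extD, smul_sub]

lemma extD_expand (α : E → E →L[ℝ] F) (x X Y T : E) (a b t a' b' t' : ℝ) :
    extD α x (a • X + b • Y + t • T) (a' • X + b' • Y + t' • T) =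
      (a * b' - a' * b) • extD α x X Y + (a * t' - a' * t) • extD α x X T
        + (b * t' - b' * t) • extD α x Y T := by
  simp only [extD_add_left, extD_add_right, extD_smul_left, extD_smul_right, extD_self,
    extD_swap α x X Y, extD_swap α x X T, extD_swap α x Y T]
  module

lemma extD_expand₂ (α : E → E →L[ℝ] F) (x X Y : E) (a b a' b' : ℝ) :
    extD α x (a • X + b • Y) (a' • X + b' • Y) = (a * b' - a' * b) • extD α x X Y := by
  simpa using extD_expand α x X Y 0 a b 0 a' b' 0

lemma extD_congr {α β : E → E →L[ℝ] F} {x : E} (h : α =ᶠ[𝓝 x] β) (v w : E) :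
    extD α x v w = extD β x v w := by
  simp [extD, h.fderiv_eq]

lemma extD_add {α β : E → E →L[ℝ] F} {x : E} (hα : DifferentiableAt ℝ α x)
    (hβ : DifferentiableAt ℝ β x) (v w : E) :
    extD (fun y => α y + β y) x v w = extD α x v w + extD β x v w := by
  simp [extD, fderiv_fun_add hα hβ]; abel

lemma extD_sub {α β : E → E →L[ℝ] F} {x : E} (hα : DifferentiableAt ℝ α x)
    (hβ : DifferentiableAt ℝ β x) (v w : E) :
    extD (fun y => α y - β y) x v w = extD α x v w - extD β x v w := by
  simp [extD, fderiv_fun_sub hα hβ]; abel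

lemma extD_clm_comp (L : F →L[ℝ] G) {α : E → E →L[ℝ] F} {x : E} (hα : DifferentiableAt ℝ α x)
    (v w : E) : extD (fun y => L.comp (α y)) x v w = L (extD α x v w) := by
  have h := (hasFDerivAt_const L x).clm_comp hα.hasFDerivAt
  simp [extD, h.fderiv]

lemma extD_bar {α : E → E →L[ℝ] ℂ} {x : E} (hα : DifferentiableAt ℝ α x) (v w : E) :
    extD (bar α) x v w = conj (extD α x v w) :=
  extD_clm_comp _ hα v w

lemma extD_toC {α : E → E →L[ℝ] ℝ} {x : E} (hα : DifferentiableAt ℝ α x) (v w : E) :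
    extD (toC α) x v w = ((extD α x v w : ℝ) : ℂ) :=
  extD_clm_comp _ hα v w

lemma extD_smul {A : Type*} [NormedField A] [NormedAlgebra ℝ A] {f : E → A}
    {α : E → E →L[ℝ] A} {x : E} (hf : DifferentiableAt ℝ f x) (hα : DifferentiableAt ℝ α x)
    (v w : E) :
    extD (fun y => f y • α y) x v w =
      f x * extD α x v w + (fderiv ℝ f x v * α x w - fderiv ℝ f x w * α x v) := by
  have h := hf.hasFDerivAt.smul hα.hasFDerivAt
  change extD (f • α) x v w = _
  simp [extD, h.fderiv]
  ring

lemma two_le_infty : minSmoothness ℝ 2 ≤ (∞ : WithTop ℕ∞) := by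
  simp only [minSmoothness_of_isRCLikeNormedField]
  exact WithTop.coe_le_coe.2 (le_top : (2:ℕ∞) ≤ ⊤)

lemma extD_fderiv {u : E → F} {x : E} (hu : ContDiffAt ℝ ∞ u x) (v w : E) :
    extD (fderiv ℝ u) x v w = 0 := by
  have := hu.isSymmSndFDerivAt (n := ∞) two_le_infty
  simp [extD, this.eq v w]

lemma contDiffAt_fderiv {f : E → F} {x : E} (h : ContDiffAt ℝ ∞ f x) :
    ContDiffAt ℝ ∞ (fderiv ℝ f) x :=
  h.fderiv_right (by simp)

lemma contDiffAt_bar {α : E → E →L[ℝ] ℂ} {x : E} (h : ContDiffAt ℝ ∞ α x) :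
    ContDiffAt ℝ ∞ (bar α) x :=
  contDiffAt_const.clm_comp h

lemma contDiffAt_toC {α : E → E →L[ℝ] ℝ} {x : E} (h : ContDiffAt ℝ ∞ α x) :
    ContDiffAt ℝ ∞ (toC α) x :=
  contDiffAt_const.clm_comp h

lemma contDiffAt_extD {α : E → E →L[ℝ] F} {X Y : E → E} {x : E} (h : ContDiffAt ℝ ∞ α x)
    (hX : ContDiffAt ℝ ∞ X x) (hY : ContDiffAt ℝ ∞ Y x) :
    ContDiffAt ℝ ∞ (fun y => extD α y (X y) (Y y)) x := by
  have := contDiffAt_fderiv h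
  exact ((this.clm_apply hX).clm_apply hY).sub ((this.clm_apply hY).clm_apply hX)

/-- `d(dα) = 0`. -/
lemma extD_extD {α : E → E →L[ℝ] F} {x : E} (h : ContDiffAt ℝ ∞ α x) (u v w : E) :
    fderiv ℝ (fun y => extD α y v w) x u + fderiv ℝ (fun y => extD α y w u) x v
      + fderiv ℝ (fun y => extD α y u v) x w = 0 := by
  have h1 := (contDiffAt_fderiv h).differentiableAt (by simp)
  have key (a b c : E) : fderiv ℝ (fun y => extD α y a b) x c =
      fderiv ℝ (fderiv ℝ α) x c a b - fderiv ℝ (fderiv ℝ α) x c b a := by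
    have e (a b : E) := (h1.hasFDerivAt.clm_apply (hasFDerivAt_const a x)).clm_apply
      (hasFDerivAt_const b x)
    have := (e a b).sub (e b a)
    change fderiv ℝ ((fun y => fderiv ℝ α y a b) - fun y => fderiv ℝ α y b a) x c = _
    rw [this.fderiv]
    simp
  have s := h.isSymmSndFDerivAt (n := ∞) two_le_infty
  rw [key, key, key, s.eq v u, s.eq w v, s.eq u w]
  abel

lemma fderiv_wedge {β γ : E → E →L[ℝ] ℂ} {x : E} (hβ : DifferentiableAt ℝ β x)
    (hγ : DifferentiableAt ℝ γ x) (u v w : E) :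
    fderiv ℝ (fun y => wedge β γ y v w) x u =
      fderiv ℝ β x u v * γ x w + β x v * fderiv ℝ γ x u w
       - (fderiv ℝ β x u w * γ x v + β x w * fderiv ℝ γ x u v) := by
  have e (β : E → E →L[ℝ] ℂ) (hβ : DifferentiableAt ℝ β x) (a : E) :=
    hβ.hasFDerivAt.clm_apply (hasFDerivAt_const a x)
  have := ((e β hβ v).mul (e γ hγ w)).sub ((e β hβ w).mul (e γ hγ v))
  change fderiv ℝ ((fun y => β y v) * (fun y => γ y w) - (fun y => β y w) * fun y => γ y v) x u = _
  rw [this.fderiv]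
  simp
  ring

lemma differentiableAt_wedge {β γ : E → E →L[ℝ] ℂ} {x : E} (hβ : DifferentiableAt ℝ β x)
    (hγ : DifferentiableAt ℝ γ x) (v w : E) :
    DifferentiableAt ℝ (fun y => wedge β γ y v w) x := by
  unfold wedge
  fun_prop

/-- If `dα = β ∧ γ + β' ∧ γ'`, then `dβ ∧ γ - β ∧ dγ + dβ' ∧ γ' - β' ∧ dγ' = 0`. -/
lemma extD_wedge_add_wedge {α β γ β' γ' : E → E →L[ℝ] ℂ} {x : E} (hα : ContDiffAt ℝ ∞ α x)
    (hβ : DifferentiableAt ℝ β x) (hγ : DifferentiableAt ℝ γ x)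
    (hβ' : DifferentiableAt ℝ β' x) (hγ' : DifferentiableAt ℝ γ' x)
    (h : ∀ᶠ y in 𝓝 x, ∀ v w, extD α y v w = wedge β γ y v w + wedge β' γ' y v w) (u v w : E) :
    (extD β x u v * γ x w + extD β x v w * γ x u + extD β x w u * γ x v)
      - (β x u * extD γ x v w + β x v * extD γ x w u + β x w * extD γ x u v)
      + (extD β' x u v * γ' x w + extD β' x v w * γ' x u + extD β' x w u * γ' x v)
      - (β' x u * extD γ' x v w + β' x v * extD γ' x w u + β' x w * extD γ' x u v) = 0 := by
  have key (a b c : E) : fderiv ℝ (fun y => extD α y a b) x c =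
      fderiv ℝ (fun y => wedge β γ y a b) x c + fderiv ℝ (fun y => wedge β' γ' y a b) x c := by
    have : (fun y => extD α y a b) =ᶠ[𝓝 x] fun y => wedge β γ y a b + wedge β' γ' y a b :=
      h.mono fun y hy => hy a b
    rw [this.fderiv_eq, fderiv_fun_add (differentiableAt_wedge hβ hγ a b)
      (differentiableAt_wedge hβ' hγ' a b)]
    rfl
  have := extD_extD hα u v w
  rw [key, key, key] at this
  simp only [fderiv_wedge hβ hγ, fderiv_wedge hβ' hγ'] at this
  simp only [extD]
  linear_combination this

/-- Pullback commutes with the exterior derivative. -/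
lemma extD_pullback {E' : Type*} [NormedAddCommGroup E'] [NormedSpace ℝ E']
    {ψ : E → E'} {β : E' → E' →L[ℝ] F} {x : E} (hψ : ContDiffAt ℝ ∞ ψ x)
    (hβ : DifferentiableAt ℝ β (ψ x)) (v w : E) :
    extD (fun y => (β (ψ y)).comp (fderiv ℝ ψ y)) x v w =
      extD β (ψ x) (fderiv ℝ ψ x v) (fderiv ℝ ψ x w) := by
  have h1 := (contDiffAt_fderiv hψ).differentiableAt (by simp)
  have h2 := (hβ.hasFDerivAt.comp x (hψ.differentiableAt (by simp)).hasFDerivAt).clm_comp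
    h1.hasFDerivAt
  -- The terms in which the derivative of ψ is itself differentiated cancel by symmetry of the
  -- second derivative.
  have s := hψ.isSymmSndFDerivAt (n := ∞) two_le_infty
  simp only [extD]
  rw [show (fun y => (β (ψ y)).comp (fderiv ℝ ψ y)) =
    fun y => ((β ∘ ψ) y).comp (fderiv ℝ ψ y) from rfl, h2.fderiv]
  simp [s.eq v w]

end LocalForm

/-! ### Contact forms and coframes in coordinates; the pseudo-Einstein condition as closedness of η.
-/

namespace LocalForm

open Filter Topology

variable {E : Type*} [NormedAddCommGroup E] [NormedSpace ℝ E]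

/-- A contact form `θ` on an open set of a normed space whose kernel has the smooth positively
oriented frame `X, Y`. -/
structure IsContact (Ω : Set E) (X Y : E → E) (θ : E → E →L[ℝ] ℝ) : Prop where
  isOpen : IsOpen Ω
  X_smooth : ∀ x ∈ Ω, ContDiffAt ℝ ∞ X x
  Y_smooth : ∀ x ∈ Ω, ContDiffAt ℝ ∞ Y x
  smooth : ∀ x ∈ Ω, ContDiffAt ℝ ∞ θ x
  X_mem : ∀ x ∈ Ω, θ x (X x) = 0
  Y_mem : ∀ x ∈ Ω, θ x (Y x) = 0
  span : ∀ x ∈ Ω, ∀ v, θ x v = 0 → ∃ a b : ℝ, v = a • X x + b • Y x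
  pos : ∀ x ∈ Ω, 0 < extD θ x (X x) (Y x)
  ne : ∀ x ∈ Ω, ∃ e, θ x e ≠ 0

/-- An admissible coframe for `θ`, relative to the frame `X, Y = J X` of the contact planes. -/
structure IsCoframe (Ω : Set E) (X Y : E → E) (θ : E → E →L[ℝ] ℝ) (θ₁ κ : E → E →L[ℝ] ℂ)
    (h R : E → ℝ) (A : E → ℂ) : Prop where
  θ₁_smooth : ∀ x ∈ Ω, ContDiffAt ℝ ∞ θ₁ x
  κ_smooth : ∀ x ∈ Ω, ContDiffAt ℝ ∞ κ x
  h_smooth : ∀ x ∈ Ω, ContDiffAt ℝ ∞ h x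
  R_smooth : ∀ x ∈ Ω, ContDiffAt ℝ ∞ R x
  A_smooth : ∀ x ∈ Ω, ContDiffAt ℝ ∞ A x
  type : ∀ x ∈ Ω, θ₁ x (Y x) = Complex.I * θ₁ x (X x)
  ne : ∀ x ∈ Ω, θ₁ x (X x) ≠ 0
  h_ne : ∀ x ∈ Ω, h x ≠ 0
  dθ_eq : ∀ x ∈ Ω, ∀ v w, ((extD θ x v w : ℝ) : ℂ) = Complex.I * h x * wedge θ₁ (bar θ₁) x v w
  dθ₁_eq : ∀ x ∈ Ω, ∀ v w, extD θ₁ x v w = wedge θ₁ κ x v w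
      + (h x : ℂ)⁻¹ * conj (A x) * wedge (toC θ) (bar θ₁) x v w
  dh_eq : ∀ x ∈ Ω, ∀ v, (h x : ℂ) * κ x v + h x * conj (κ x v) = ((fderiv ℝ h x v : ℝ) : ℂ)
  dκ_eq : ∀ x ∈ Ω, extD κ x (X x) (Y x) = R x * h x * wedge θ₁ (bar θ₁) x (X x) (Y x)

/-- The form `ω₁¹ + i R θ`, whose closedness is the pseudo-Einstein condition. -/
def eta (κ : E → E →L[ℝ] ℂ) (R : E → ℝ) (θ : E → E →L[ℝ] ℝ) : E → E →L[ℝ] ℂ :=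
  fun y => κ y + (Complex.I * R y) • toC θ y

/-- The component `W₁` with `Z₁ = (V - i V') / 2`. -/
def compW (h R : E → ℝ) (A : E → ℂ) (κ : E → E →L[ℝ] ℂ) (x V V' : E) : ℂ :=
  ((fderiv ℝ R x V : ℂ) - Complex.I * (fderiv ℝ R x V' : ℂ)) / 2
    - Complex.I * ((h x : ℂ)⁻¹ * (((fderiv ℝ A x V - 2 * A x * κ x V)
      + Complex.I * (fderiv ℝ A x V' - 2 * A x * κ x V')) / 2))

variable {Ω : Set E} {X Y : E → E} {θ θ' : E → E →L[ℝ] ℝ} {θ₁ κ θ₁' κ' : E → E →L[ℝ] ℂ}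
  {h R h' R' : E → ℝ} {A A' : E → ℂ} {x : E}

/-- The Reeb field, obtained from a transverse vector `e`. -/
def reeb (X Y : E → E) (θ : E → E →L[ℝ] ℝ) (e : E) (y : E) : E :=
  (θ y e)⁻¹ • e - ((extD θ y (X y) (Y y))⁻¹ * ((θ y e)⁻¹ * extD θ y e (Y y))) • X y
    + ((extD θ y (X y) (Y y))⁻¹ * ((θ y e)⁻¹ * extD θ y e (X y))) • Y y

/-- The real part of a connection form with `h (κ + conj κ) = dh` is closed. -/
lemma extD_add_conj_of_log (hΩ : IsOpen Ω) (sκ : ∀ x ∈ Ω, ContDiffAt ℝ ∞ κ x)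
    (sh : ∀ x ∈ Ω, ContDiffAt ℝ ∞ h x) (h_ne : ∀ x ∈ Ω, h x ≠ 0)
    (dh : ∀ x ∈ Ω, ∀ v, (h x : ℂ) * κ x v + h x * conj (κ x v) = ((fderiv ℝ h x v : ℝ) : ℂ))
    (hx : x ∈ Ω) (v w : E) : extD κ x v w + conj (extD κ x v w) = 0 := by
  -- Division by h gives κ + conj κ = d log |h|. As `Real.log` is the logarithm of the absolute
  -- value, h ≠ 0 suffices.
  have e1 : (fun y => κ y + bar κ y) =ᶠ[𝓝 x] toC (fderiv ℝ (fun y => Real.log (h y))) := by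
    filter_upwards [hΩ.mem_nhds hx] with y hy
    ext v
    have hh : (h y : ℂ) ≠ 0 := by exact_mod_cast h_ne y hy
    have := ((sh y hy).differentiableAt (by simp)).hasFDerivAt.log (h_ne y hy)
    have e := dh y hy v
    simp only [toC_apply, this.fderiv]
    simp only [add_apply, bar_apply, smul_apply,
      smul_eq_mul, Complex.ofReal_mul, Complex.ofReal_inv]
    rw [← e]
    field_simp
  have hκ := (sκ x hx).differentiableAt (by simp)
  have hl := (sh x hx).log (h_ne x hx)
  rw [← extD_bar hκ, ← extD_add hκ ((contDiffAt_bar (sκ x hx)).differentiableAt (by simp)),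
    extD_congr e1, extD_toC ((contDiffAt_fderiv hl).differentiableAt (by simp)), extD_fderiv hl]
  simp

namespace IsContact

lemma θ_reeb (hc : IsContact Ω X Y θ) (hx : x ∈ Ω) {e : E} (he : θ x e ≠ 0) :
    θ x (reeb X Y θ e x) = 1 := by
  simp [reeb, hc.X_mem x hx, hc.Y_mem x hx, he]

lemma extD_reeb_X (hc : IsContact Ω X Y θ) (hx : x ∈ Ω) (e : E) :
    extD θ x (reeb X Y θ e x) (X x) = 0 := by
  have := (hc.pos x hx).ne'
  simp only [reeb, sub_eq_add_neg, ← neg_smul, extD_add_left, extD_smul_left, extD_self,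
    extD_swap θ x (X x) (Y x), smul_eq_mul]
  field_simp
  ring

lemma extD_reeb_Y (hc : IsContact Ω X Y θ) (hx : x ∈ Ω) (e : E) :
    extD θ x (reeb X Y θ e x) (Y x) = 0 := by
  have := (hc.pos x hx).ne'
  simp only [reeb, sub_eq_add_neg, ← neg_smul, extD_add_left, extD_smul_left, extD_self,
    smul_eq_mul]
  field_simp
  ring

lemma contDiffAt_reeb (hc : IsContact Ω X Y θ) (hx : x ∈ Ω) {e : E} (he : θ x e ≠ 0) :
    ContDiffAt ℝ ∞ (reeb X Y θ e) x := by
  have h1 := hc.X_smooth x hx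
  have h2 := hc.Y_smooth x hx
  have h3 := hc.smooth x hx
  have h4 : ContDiffAt ℝ ∞ (fun y => (θ y e)⁻¹) x := (h3.clm_apply contDiffAt_const).inv he
  have h5 := (contDiffAt_extD h3 h1 h2).inv (hc.pos x hx).ne'
  exact ((h4.smul contDiffAt_const).sub ((h5.mul (h4.mul
    (contDiffAt_extD h3 contDiffAt_const h2))).smul h1)).add ((h5.mul (h4.mul
    (contDiffAt_extD h3 contDiffAt_const h1))).smul h2)

lemma exists_decomp (hc : IsContact Ω X Y θ) (hx : x ∈ Ω) {T : E} (hT : θ x T = 1) (v : E) :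
    ∃ a b t : ℝ, v = a • X x + b • Y x + t • T := by
  obtain ⟨a, b, hab⟩ := hc.span x hx (v - θ x v • T) (by simp [hT])
  exact ⟨a, b, θ x v, by rw [← hab]; abel⟩

lemma exists_reeb (hc : IsContact Ω X Y θ) (hx : x ∈ Ω) :
    ∃ T, θ x T = 1 ∧ extD θ x T (X x) = 0 ∧ extD θ x T (Y x) = 0 := by
  obtain ⟨e, he⟩ := hc.ne x hx
  exact ⟨_, hc.θ_reeb hx he, hc.extD_reeb_X hx e, hc.extD_reeb_Y hx e⟩

lemma clm_ext {F : Type*} [NormedAddCommGroup F] [NormedSpace ℝ F] (hc : IsContact Ω X Y θ)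
    (hx : x ∈ Ω) {e : E} (he : θ x e ≠ 0) {L L' : E →L[ℝ] F} (hX : L (X x) = L' (X x))
    (hY : L (Y x) = L' (Y x)) (hT : L e = L' e) : L = L' := by
  ext v
  obtain ⟨a, b, t, rfl⟩ := hc.exists_decomp hx (T := (θ x e)⁻¹ • e) (by simp [he]) v
  simp [hX, hY, hT]

lemma extD_eq_zero {F : Type*} [NormedAddCommGroup F] [NormedSpace ℝ F] (hc : IsContact Ω X Y θ)
    (hx : x ∈ Ω) {T : E} (hT : θ x T = 1) {α : E → E →L[ℝ] F} (h1 : extD α x (X x) (Y x) = 0)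
    (h2 : extD α x (X x) T = 0) (h3 : extD α x (Y x) T = 0) (v w : E) : extD α x v w = 0 := by
  obtain ⟨a, b, t, rfl⟩ := hc.exists_decomp hx hT v
  obtain ⟨a', b', t', rfl⟩ := hc.exists_decomp hx hT w
  simp [extD_expand, h1, h2, h3]

lemma mono (hc : IsContact Ω X Y θ) {Ω' : Set E} (ho : IsOpen Ω') (hs : Ω' ⊆ Ω) :
    IsContact Ω' X Y θ where
  isOpen := ho
  X_smooth x hx := hc.X_smooth x (hs hx)
  Y_smooth x hx := hc.Y_smooth x (hs hx)
  smooth x hx := hc.smooth x (hs hx)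
  X_mem x hx := hc.X_mem x (hs hx)
  Y_mem x hx := hc.Y_mem x (hs hx)
  span x hx := hc.span x (hs hx)
  pos x hx := hc.pos x (hs hx)
  ne x hx := hc.ne x (hs hx)

end IsContact

namespace IsCoframe

lemma mono (hC : IsCoframe Ω X Y θ θ₁ κ h R A) {Ω' : Set E} (hs : Ω' ⊆ Ω) :
    IsCoframe Ω' X Y θ θ₁ κ h R A where
  θ₁_smooth x hx := hC.θ₁_smooth x (hs hx)
  κ_smooth x hx := hC.κ_smooth x (hs hx)
  h_smooth x hx := hC.h_smooth x (hs hx)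
  R_smooth x hx := hC.R_smooth x (hs hx)
  A_smooth x hx := hC.A_smooth x (hs hx)
  type x hx := hC.type x (hs hx)
  ne x hx := hC.ne x (hs hx)
  h_ne x hx := hC.h_ne x (hs hx)
  dθ_eq x hx := hC.dθ_eq x (hs hx)
  dθ₁_eq x hx := hC.dθ₁_eq x (hs hx)
  dh_eq x hx := hC.dh_eq x (hs hx)
  dκ_eq x hx := hC.dκ_eq x (hs hx)

/-- Contract dθ = ih θ¹ ∧ conj θ¹ with T. Since θ¹(Y) = iθ¹(X), a complex combination of the values
on X and Y removes conj θ¹(T) and leaves a nonzero multiple of θ¹(T). -/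
lemma θ₁_reeb (hC : IsCoframe Ω X Y θ θ₁ κ h R A) (hx : x ∈ Ω) {T : E}
    (h1 : extD θ x T (X x) = 0) (h2 : extD θ x T (Y x) = 0) : θ₁ x T = 0 := by
  have e1 := hC.dθ_eq x hx T (X x)
  have e2 := hC.dθ_eq x hx T (Y x)
  have hh : (h x : ℂ) ≠ 0 := by exact_mod_cast hC.h_ne x hx
  have hm : conj (θ₁ x (X x)) ≠ 0 := by simpa using hC.ne x hx
  simp only [h1, h2, wedge, hC.type x hx, bar_apply, map_mul, Complex.conj_I,
    Complex.ofReal_zero] at e1 e2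
  have : (h x : ℂ) * conj (θ₁ x (X x)) * θ₁ x T * 2 = 0 := by
    linear_combination Complex.I * e1 - e2
      + (2 * h x * conj (θ₁ x (X x)) * θ₁ x T) * Complex.I_sq
  simpa [hh, hm] using this

lemma eq_zero (hc : IsContact Ω X Y θ) (hC : IsCoframe Ω X Y θ θ₁ κ h R A) (hx : x ∈ Ω) {v : E}
    (h0 : θ x v = 0) (h1 : θ₁ x v = 0) : v = 0 := by
  obtain ⟨a, b, rfl⟩ := hc.span x hx v h0
  have : ((a : ℂ) + b * Complex.I) * θ₁ x (X x) = 0 := by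
    simp only [map_add, map_smul, hC.type x hx, Complex.real_smul] at h1
    linear_combination h1
  have h2 := (mul_eq_zero.1 this).resolve_right (hC.ne x hx)
  have ha : a = 0 := by simpa using congrArg Complex.re h2
  have hb : b = 0 := by simpa using congrArg Complex.im h2
  simp [ha, hb]

/-- The pair V, V' dual to θ¹ is used only at one point, whereas X, Y is the smooth frame; this
passes from one to the other. -/
lemma eq_combination (hc : IsContact Ω X Y θ) (hC : IsCoframe Ω X Y θ θ₁ κ h R A) (hx : x ∈ Ω)
    {V V' v : E} (hV : θ x V = 0) (hV' : θ x V' = 0) (h1 : θ₁ x V = 1)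
    (h1' : θ₁ x V' = Complex.I) (hv : θ x v = 0) :
    v = (θ₁ x v).re • V + (θ₁ x v).im • V' := by
  rw [← sub_eq_zero]
  refine hC.eq_zero hc hx (by simp [hV, hV', hv]) ?_
  simp only [map_sub, map_add, map_smul, h1, h1', Complex.real_smul, mul_one]
  rw [Complex.re_add_im, sub_self]

lemma extD_add_conj (hc : IsContact Ω X Y θ) (hC : IsCoframe Ω X Y θ θ₁ κ h R A) (hx : x ∈ Ω)
    (v w : E) : extD κ x v w + conj (extD κ x v w) = 0 :=
  extD_add_conj_of_log hc.isOpen hC.κ_smooth hC.h_smooth hC.h_ne hC.dh_eq hx v w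

lemma extD_eta (hc : IsContact Ω X Y θ) (hC : IsCoframe Ω X Y θ θ₁ κ h R A) (hx : x ∈ Ω)
    (v w : E) : extD (eta κ R θ) x v w = extD κ x v w + Complex.I * (R x * extD θ x v w
      + (fderiv ℝ R x v * θ x w - fderiv ℝ R x w * θ x v) : ℝ) := by
  have hκ := (hC.κ_smooth x hx).differentiableAt (by simp)
  have hR := (hC.R_smooth x hx).differentiableAt (by simp)
  have hθ := hc.smooth x hx
  have hf : HasFDerivAt (fun y => Complex.I * (R y : ℂ))
      (Complex.I • Complex.ofRealCLM.comp (fderiv ℝ R x)) x :=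
    (Complex.ofRealCLM.hasFDerivAt.comp x hR.hasFDerivAt).const_mul Complex.I
  have hθ' := (contDiffAt_toC hθ).differentiableAt (by simp)
  have hs : DifferentiableAt ℝ (fun y => (Complex.I * (R y : ℂ)) • toC θ y) x :=
    hf.differentiableAt.smul hθ'
  unfold eta
  rw [extD_add hκ hs, extD_smul hf.differentiableAt hθ', hf.fderiv,
    extD_toC (hθ.differentiableAt (by simp))]
  simp
  ring

lemma extD_eta_add_conj (hc : IsContact Ω X Y θ) (hC : IsCoframe Ω X Y θ θ₁ κ h R A) (hx : x ∈ Ω)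
    (v w : E) : extD (eta κ R θ) x v w + conj (extD (eta κ R θ) x v w) = 0 := by
  have := hC.extD_add_conj hc hx v w
  rw [hC.extD_eta hc hx, map_add, map_mul, Complex.conj_I, Complex.conj_ofReal]
  linear_combination this

/-- This is the reason for the term iRθ: on H, dκ = Rh θ¹ ∧ conj θ¹ and iR dθ = i²Rh θ¹ ∧ conj θ¹
cancel. -/
lemma extD_eta_frame (hc : IsContact Ω X Y θ) (hC : IsCoframe Ω X Y θ θ₁ κ h R A) (hx : x ∈ Ω) :
    extD (eta κ R θ) x (X x) (Y x) = 0 := by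
  rw [hC.extD_eta hc hx, hC.dκ_eq x hx, hc.X_mem x hx, hc.Y_mem x hx]
  have := hC.dθ_eq x hx (X x) (Y x)
  push_cast
  rw [this]
  linear_combination (R x * h x * wedge θ₁ (bar θ₁) x (X x) (Y x)) * Complex.I_sq

/-- The identity d(dθ¹) = 0, evaluated on (V, V', T). As V + iV' is twice the conjugate of Z₁, the
left side is the (Z̄₁, T) component of dκ, up to the factor 2, and the right side is the conjugate
of ∇_{1̄}A₁₁. -/
lemma extD_conn_reeb (hc : IsContact Ω X Y θ) (hC : IsCoframe Ω X Y θ θ₁ κ h R A) (hx : x ∈ Ω)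
    {V V' T : E} (hV : θ x V = 0) (hV' : θ x V' = 0) (hT : θ x T = 1) (h1 : θ₁ x V = 1)
    (h1' : θ₁ x V' = Complex.I) (h1T : θ₁ x T = 0) :
    (extD κ x V T + Complex.I * extD κ x V' T) =
      - (h x : ℂ)⁻¹ * conj (fderiv ℝ A x V - 2 * A x * κ x V
        + Complex.I * (fderiv ℝ A x V' - 2 * A x * κ x V')) := by
  have hh : (h x : ℂ) ≠ 0 := by exact_mod_cast hC.h_ne x hx
  have hθ := hc.smooth x hx
  have hθ₁ := hC.θ₁_smooth x hx
  have hκ := hC.κ_smooth x hx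
  have dh := ((hC.h_smooth x hx).differentiableAt (by simp)).hasFDerivAt
  have dA := ((hC.A_smooth x hx).differentiableAt (by simp)).hasFDerivAt
  have dhC : HasFDerivAt (fun y => (h y : ℂ)) (Complex.ofRealCLM.comp (fderiv ℝ h x)) x :=
    Complex.ofRealCLM.hasFDerivAt.comp x dh
  have dAC : HasFDerivAt (fun y => conj (A y)) ((Complex.conjCLE : ℂ →L[ℝ] ℂ).comp (fderiv ℝ A x)) x :=
    (Complex.conjCLE : ℂ →L[ℝ] ℂ).hasFDerivAt.comp x dA
  have dq : HasFDerivAt (fun y => (h y : ℂ)⁻¹ * conj (A y)) _ x :=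
    ((hasDerivAt_inv hh).comp_hasFDerivAt x dhC).mul dAC
  have hθC := (contDiffAt_toC hθ).differentiableAt (by simp)
  have key := extD_wedge_add_wedge (α := θ₁) (β := θ₁) (γ := κ)
    (β' := fun y => ((h y : ℂ)⁻¹ * conj (A y)) • toC θ y) (γ' := bar θ₁) hθ₁
    (hθ₁.differentiableAt (by simp)) (hκ.differentiableAt (by simp))
    (dq.differentiableAt.smul hθC) ((contDiffAt_bar hθ₁).differentiableAt (by simp)) (by
      filter_upwards [hc.isOpen.mem_nhds hx] with y hy v w
      rw [hC.dθ₁_eq y hy]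
      simp [wedge]
      ring) V V' T
  simp only [extD_smul dq.differentiableAt hθC, dq.fderiv,
    extD_toC (hθ.differentiableAt (by simp)), extD_bar (hθ₁.differentiableAt (by simp)),
    hC.dθ₁_eq x hx, hC.dθ_eq x hx, wedge] at key
  have dV := hC.dh_eq x hx V
  have dV' := hC.dh_eq x hx V'
  simp [hV, hV', hT, h1, h1', h1T, extD_swap κ x V T] at key
  -- Writing dh as h(κ + conj κ) turns the derivative of h⁻¹ conj A into the covariant derivative of
  -- the torsion.
  rw [← dV, ← dV'] at key
  simp only [map_add, map_sub, map_mul, Complex.conj_I]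
  field_simp at key ⊢
  rw [map_ofNat]
  linear_combination (norm := (ring_nf; simp only [Complex.I_sq]; ring)) (-Complex.I) * key

/-- A two-form is determined by its values on (X, Y), (X, T), (Y, T). The first vanishes for dη.
Since dη is imaginary, the other two carry one complex number, dη(Z₁, T) = iW₁. -/
lemma compW_eq_zero_iff (hc : IsContact Ω X Y θ) (hC : IsCoframe Ω X Y θ θ₁ κ h R A) (hx : x ∈ Ω)
    {V V' : E} (hV : θ x V = 0) (hV' : θ x V' = 0) (h1 : θ₁ x V = 1) (h1' : θ₁ x V' = Complex.I) :
    compW h R A κ x V V' = 0 ↔ ∀ v w, extD (eta κ R θ) x v w = 0 := by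
  obtain ⟨T, hT, hTX, hTY⟩ := hc.exists_reeb hx
  have h1T := hC.θ₁_reeb hx hTX hTY
  have hVT : extD θ x V T = 0 := by
    have := hC.dθ_eq x hx V T
    simpa [wedge, h1T] using this
  have hVT' : extD θ x V' T = 0 := by
    have := hC.dθ_eq x hx V' T
    simpa [wedge, h1T] using this
  have key := hC.extD_conn_reeb hc hx hV hV' hT h1 h1' h1T
  have e1 := hC.extD_eta hc hx V T
  have e2 := hC.extD_eta hc hx V' T
  have c1 := hC.extD_add_conj hc hx V T
  have c2 := hC.extD_add_conj hc hx V' T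
  rw [hVT, hT, hV] at e1
  rw [hVT', hT, hV'] at e2
  -- Conjugating `key` and using that dκ is imaginary gives the Z₁ component of dκ; the ∇₁R part of
  -- W₁ comes from iR θ.
  have hW : extD (eta κ R θ) x V T - Complex.I * extD (eta κ R θ) x V' T
      = 2 * Complex.I * compW h R A κ x V V' := by
    have k := congrArg conj key
    simp only [map_add, map_mul, map_neg, map_inv₀, Complex.conj_I, Complex.conj_ofReal,
      Complex.conj_conj] at k
    rw [e1, e2, compW]
    push_cast
    linear_combination (norm := (ring_nf; simp only [Complex.I_sq]; ring))
      c1 - Complex.I * c2 - k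
        + Complex.I * (h x : ℂ)⁻¹ * (fderiv ℝ A x V' - 2 * A x * κ x V') * Complex.I_sq
  constructor
  · intro h0
    rw [h0, mul_zero] at hW
    have d1 := hC.extD_eta_add_conj hc hx V T
    have d2 := hC.extD_eta_add_conj hc hx V' T
    -- For an imaginary dη, the conjugate equation is the vanishing of the Z̄₁ component, so V and
    -- V' can be treated separately.
    have hW' := congrArg conj hW
    simp only [map_sub, map_mul, Complex.conj_I, map_zero] at hW'
    have z1 : extD (eta κ R θ) x V T = 0 := by
      linear_combination (1 / 2) * hW - (1 / 2) * hW' + (1 / 2) * d1 + (1 / 2) * Complex.I * d2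
    have z2 : extD (eta κ R θ) x V' T = 0 := by
      rw [z1] at hW
      simpa using hW
    have hX : extD (eta κ R θ) x (X x) T = 0 := by
      rw [hC.eq_combination hc hx hV hV' h1 h1' (hc.X_mem x hx), extD_add_left, extD_smul_left,
        extD_smul_left, z1, z2]
      simp
    have hY : extD (eta κ R θ) x (Y x) T = 0 := by
      rw [hC.eq_combination hc hx hV hV' h1 h1' (hc.Y_mem x hx), extD_add_left, extD_smul_left,
        extD_smul_left, z1, z2]
      simp
    exact hc.extD_eq_zero hx hT (hC.extD_eta_frame hc hx) hX hY
  · intro h0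
    rw [h0, h0] at hW
    simpa using hW.symm

end IsCoframe

end LocalForm

/-! ### Local existence of admissible coframes. -/

namespace LocalForm

open Filter Topology

variable {E : Type*} [NormedAddCommGroup E] [NormedSpace ℝ E]
variable {Ω : Set E} {X Y : E → E} {θ θ' : E → E →L[ℝ] ℝ} {θ₁ κ θ₁' κ' : E → E →L[ℝ] ℂ}
  {h R h' R' : E → ℝ} {A A' : E → ℂ} {x : E}

lemma contDiffAt_ofReal {f : E → ℝ} (hf : ContDiffAt ℝ ∞ f x) :
    ContDiffAt ℝ ∞ (fun y => (f y : ℂ)) x :=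
  Complex.ofRealCLM.contDiff.contDiffAt.comp x hf

lemma contDiffAt_conj {f : E → ℂ} (hf : ContDiffAt ℝ ∞ f x) :
    ContDiffAt ℝ ∞ (fun y => conj (f y)) x :=
  Complex.conjCLE.contDiff.contDiffAt.comp x hf

/-- The contraction of `dα` with a vector field. -/
def contract (α : E → E →L[ℝ] ℝ) (V : E → E) (y : E) : E →L[ℝ] ℝ :=
  fderiv ℝ α y (V y) - (ContinuousLinearMap.apply ℝ ℝ (V y)).comp (fderiv ℝ α y)

@[simp] lemma contract_apply (α : E → E →L[ℝ] ℝ) (V : E → E) (y v : E) :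
    contract α V y v = extD α y (V y) v := by
  simp [contract, extD]

lemma contDiffAt_contract {α : E → E →L[ℝ] ℝ} {V : E → E} (hα : ContDiffAt ℝ ∞ α x)
    (hV : ContDiffAt ℝ ∞ V x) : ContDiffAt ℝ ∞ (contract α V) x := by
  have h1 := contDiffAt_fderiv hα
  have h2 : ContDiffAt ℝ ∞ (fun y => ContinuousLinearMap.apply ℝ ℝ (V y)) x :=
    contDiffAt_const.clm_apply hV
  exact (h1.clm_apply hV).sub (h2.clm_comp h1)

namespace IsContact

/-- The contact form `θ` has a normalized smooth `(1,0)`-form. -/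
lemma exists_unitary_form (hc : IsContact Ω X Y θ) : ∃ θ₁ : E → E →L[ℝ] ℂ, ∀ x ∈ Ω,
    ContDiffAt ℝ ∞ θ₁ x ∧ θ₁ x (X x) = 1 ∧ θ₁ x (Y x) = Complex.I ∧
      ∀ T, extD θ x T (X x) = 0 → extD θ x T (Y x) = 0 → θ₁ x T = 0 := by
  -- Contractions of dθ with X and Y annihilate the Reeb field automatically, and dθ(X, Y)
  -- normalizes the values on X and Y.
  refine ⟨fun y => ((extD θ y (X y) (Y y) : ℝ) : ℂ)⁻¹ •
    (Complex.I • toC (contract θ X) y - toC (contract θ Y) y), fun x hx => ?_⟩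
  have hpos : ((extD θ x (X x) (Y x) : ℝ) : ℂ) ≠ 0 := by exact_mod_cast (hc.pos x hx).ne'
  refine ⟨?_, ?_, ?_, ?_⟩
  · have h0 := hc.smooth x hx
    have h1 := hc.X_smooth x hx
    have h2 := hc.Y_smooth x hx
    have h3 := contDiffAt_toC (contDiffAt_contract h0 h1)
    have h4 := contDiffAt_toC (contDiffAt_contract h0 h2)
    have h5 := (contDiffAt_ofReal (contDiffAt_extD h0 h1 h2)).inv hpos
    exact h5.smul ((contDiffAt_const (c := Complex.I).smul h3).sub h4)
  · simp [extD_swap θ x (X x) (Y x), hpos]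
  · simp
    field_simp
  · intro T hX hY
    simp [extD_swap θ x T (X x), extD_swap θ x T (Y x), hX, hY]

/-- With θ¹(X) = 1, θ¹(Y) = i and θ¹(T) = 0, the structure equations are linear in the unknowns and
can be solved explicitly. The compatibility conditions left over follow from d(dθ) = 0 and from dκ
being imaginary. -/
lemma exists_isCoframe_of_transverse (hc : IsContact Ω X Y θ) {e : E} (he : ∀ x ∈ Ω, θ x e ≠ 0) :
    ∃ θ₁ κ h R A, IsCoframe Ω X Y θ θ₁ κ h R A := by
  obtain ⟨θ₁, hθ₁⟩ := hc.exists_unitary_form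
  set T := reeb X Y θ e
  -- Here θ¹ ∧ conj θ¹ takes the value -2i on (X, Y), whence the factors 1/2. The functions p, q, r
  -- are the coefficients in dθ¹ = p θ¹ ∧ conj θ¹ + q θ ∧ θ¹ + r θ ∧ conj θ¹.
  let h : E → ℝ := fun y => extD θ y (X y) (Y y) / 2
  let p : E → ℂ := fun y => Complex.I / 2 * extD θ₁ y (X y) (Y y)
  let q : E → ℂ := fun y => (extD θ₁ y (T y) (X y) - Complex.I * extD θ₁ y (T y) (Y y)) / 2
  let r : E → ℂ := fun y => (extD θ₁ y (T y) (X y) + Complex.I * extD θ₁ y (T y) (Y y)) / 2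
  -- The equation for dθ¹ does not see the θ¹ coefficient of κ. It is fixed by a + conj p = h⁻¹ Z₁h,
  -- which is h(κ + conj κ) = dh on H.
  let a : E → ℂ := fun y => (2 * (h y : ℂ))⁻¹ *
    ((fderiv ℝ h y (X y) : ℝ) - Complex.I * (fderiv ℝ h y (Y y) : ℝ)) - conj (p y)
  let κ : E → E →L[ℝ] ℂ := fun y => a y • θ₁ y + p y • bar θ₁ y - q y • toC θ y
  let A : E → ℂ := fun y => h y * conj (r y)
  let R : E → ℝ := fun y =>
    (Complex.I * ((2 * (h y : ℂ))⁻¹ * extD κ y (X y) (Y y))).re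
  have hX y (hy : y ∈ Ω) := (hθ₁ y hy).2.1
  have hY y (hy : y ∈ Ω) := (hθ₁ y hy).2.2.1
  have hT y (hy : y ∈ Ω) : θ₁ y (T y) = 0 :=
    (hθ₁ y hy).2.2.2 _ (hc.extD_reeb_X hy e) (hc.extD_reeb_Y hy e)
  have hθT y (hy : y ∈ Ω) : θ y (T y) = 1 := hc.θ_reeb hy (he y hy)
  have sh y (hy : y ∈ Ω) : ContDiffAt ℝ ∞ h y :=
    (contDiffAt_extD (hc.smooth y hy) (hc.X_smooth y hy) (hc.Y_smooth y hy)).div_const 2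
  have h_pos y (hy : y ∈ Ω) : 0 < h y := half_pos (hc.pos y hy)
  have sT y (hy : y ∈ Ω) : ContDiffAt ℝ ∞ T y := hc.contDiffAt_reeb hy (he y hy)
  have sp y (hy : y ∈ Ω) : ContDiffAt ℝ ∞ p y :=
    contDiffAt_const.mul (contDiffAt_extD (hθ₁ y hy).1 (hc.X_smooth y hy) (hc.Y_smooth y hy))
  have sTX y (hy : y ∈ Ω) :=
    contDiffAt_extD (hθ₁ y hy).1 (sT y hy) (hc.X_smooth y hy)
  have sTY y (hy : y ∈ Ω) :=
    contDiffAt_extD (hθ₁ y hy).1 (sT y hy) (hc.Y_smooth y hy)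
  have sq y (hy : y ∈ Ω) : ContDiffAt ℝ ∞ q y :=
    ((sTX y hy).sub (contDiffAt_const.mul (sTY y hy))).div_const 2
  have sr y (hy : y ∈ Ω) : ContDiffAt ℝ ∞ r y :=
    ((sTX y hy).add (contDiffAt_const.mul (sTY y hy))).div_const 2
  have si y (hy : y ∈ Ω) : ContDiffAt ℝ ∞ (fun y => (2 * (h y : ℂ))⁻¹) y := by
    refine (contDiffAt_const.mul (contDiffAt_ofReal (sh y hy))).inv ?_
    have := (h_pos y hy).ne'
    simpa using this
  have sa y (hy : y ∈ Ω) : ContDiffAt ℝ ∞ a y := by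
    have d := contDiffAt_fderiv (sh y hy)
    exact ((si y hy).mul ((contDiffAt_ofReal (d.clm_apply (hc.X_smooth y hy))).sub
      (contDiffAt_const.mul (contDiffAt_ofReal (d.clm_apply (hc.Y_smooth y hy)))))).sub
      (contDiffAt_conj (sp y hy))
  have sκ y (hy : y ∈ Ω) : ContDiffAt ℝ ∞ κ y :=
    (((sa y hy).smul (hθ₁ y hy).1).add ((sp y hy).smul (contDiffAt_bar (hθ₁ y hy).1))).sub
      ((sq y hy).smul (contDiffAt_toC (hc.smooth y hy)))
  have sR y (hy : y ∈ Ω) : ContDiffAt ℝ ∞ R y :=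
    Complex.reCLM.contDiff.contDiffAt.comp y (contDiffAt_const.mul ((si y hy).mul
      (contDiffAt_extD (sκ y hy) (hc.X_smooth y hy) (hc.Y_smooth y hy))))
  have κ_apply y v : κ y v = a y * θ₁ y v + p y * conj (θ₁ y v) - q y * θ y v := by
    simp [κ]
  have dθ y (hy : y ∈ Ω) v w :
      ((extD θ y v w : ℝ) : ℂ) = Complex.I * h y * wedge θ₁ (bar θ₁) y v w := by
    obtain ⟨v1, v2, v3, rfl⟩ := hc.exists_decomp hy (hθT y hy) v
    obtain ⟨w1, w2, w3, rfl⟩ := hc.exists_decomp hy (hθT y hy) w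
    rw [extD_expand, extD_swap θ y (T y) (X y), extD_swap θ y (T y) (Y y), hc.extD_reeb_X hy,
      hc.extD_reeb_Y hy]
    simp only [wedge, bar_apply, map_add, map_smul, hX y hy, hY y hy, hT y hy,
      Complex.real_smul, Complex.conj_I, map_one, map_zero, smul_eq_mul, h]
    push_cast
    linear_combination (norm := (ring_nf; simp only [Complex.I_sq]; ring))
  have dθ₁ y (hy : y ∈ Ω) v w : extD θ₁ y v w = wedge θ₁ κ y v w
      + (h y : ℂ)⁻¹ * conj (A y) * wedge (toC θ) (bar θ₁) y v w := by
    have hh : (h y : ℂ) ≠ 0 := by exact_mod_cast (h_pos y hy).ne'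
    have hA : (h y : ℂ)⁻¹ * conj (A y) = r y := by simp [A, hh]
    rw [hA]
    obtain ⟨v1, v2, v3, rfl⟩ := hc.exists_decomp hy (hθT y hy) v
    obtain ⟨w1, w2, w3, rfl⟩ := hc.exists_decomp hy (hθT y hy) w
    rw [extD_expand, extD_swap θ₁ y (T y) (X y), extD_swap θ₁ y (T y) (Y y)]
    simp only [wedge, bar_apply, toC_apply, κ_apply, map_add, map_smul, hX y hy, hY y hy,
      hT y hy, hc.X_mem y hy, hc.Y_mem y hy, hθT y hy,
      Complex.real_smul, map_mul, Complex.conj_ofReal, Complex.conj_I, map_one, smul_eq_mul, p, q,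
      r, map_zero]
    push_cast
    linear_combination (norm := (ring_nf; simp only [Complex.I_sq]; ring))
  -- Along T there is no freedom left in κ; compatibility with dh is the (X, Y, T) component of d(ih
  -- θ¹ ∧ conj θ¹) = 0.
  have dhT y (hy : y ∈ Ω) :
      (h y : ℂ) * (q y + conj (q y)) + (fderiv ℝ h y (T y) : ℝ) = 0 := by
    have hθ := hc.smooth y hy
    have s1 := (hθ₁ y hy).1
    have dhC : HasFDerivAt (fun y => Complex.I * (h y : ℂ))
        (Complex.I • Complex.ofRealCLM.comp (fderiv ℝ h y)) y :=
      (Complex.ofRealCLM.hasFDerivAt.comp y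
        ((sh y hy).differentiableAt (by simp)).hasFDerivAt).const_mul Complex.I
    have key := extD_wedge_add_wedge (α := toC θ) (β := fun y => (Complex.I * (h y : ℂ)) • θ₁ y)
      (γ := bar θ₁) (β' := fun _ => 0) (γ' := fun _ => 0) (contDiffAt_toC hθ)
      (dhC.differentiableAt.smul (s1.differentiableAt (by simp)))
      ((contDiffAt_bar s1).differentiableAt (by simp)) (differentiableAt_const _)
      (differentiableAt_const _) (by
        filter_upwards [hc.isOpen.mem_nhds hy] with z hz v w
        rw [extD_toC ((hc.smooth z hz).differentiableAt (by simp)), dθ z hz]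
        simp [wedge]
        ring) (X y) (Y y) (T y)
    simp only [extD_smul dhC.differentiableAt (s1.differentiableAt (by simp)), dhC.fderiv,
      extD_bar (s1.differentiableAt (by simp)), extD_swap θ₁ y (T y) (Y y)] at key
    simp [hX y hy, hY y hy, hT y hy] at key
    simp only [q, map_sub, map_div₀, map_mul, Complex.conj_I, map_ofNat]
    linear_combination (norm := (ring_nf; simp only [Complex.I_sq]; ring)) (1 / 2) * key
  have dh y (hy : y ∈ Ω) v :
      (h y : ℂ) * κ y v + h y * conj (κ y v) = ((fderiv ℝ h y v : ℝ) : ℂ) := by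
    have hh : (h y : ℂ) ≠ 0 := by exact_mod_cast (h_pos y hy).ne'
    have key := dhT y hy
    obtain ⟨v1, v2, v3, rfl⟩ := hc.exists_decomp hy (hθT y hy) v
    simp only [κ_apply, map_add, map_sub, map_smul, hX y hy, hY y hy,
      hT y hy, hc.X_mem y hy, hc.Y_mem y hy, hθT y hy, a,
      Complex.real_smul, map_mul, Complex.conj_ofReal, Complex.conj_I, map_one, smul_eq_mul,
      map_zero, map_neg, map_inv₀, map_ofNat, Complex.conj_conj]
    push_cast
    field_simp
    linear_combination (norm := (ring_nf; simp only [Complex.I_sq]; ring)) (-2 * v3 : ℂ) * key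
  refine ⟨θ₁, κ, h, R, A, fun y hy => (hθ₁ y hy).1, sκ, fun y hy => sh y hy, sR,
    fun y hy => (contDiffAt_ofReal (sh y hy)).mul (contDiffAt_conj (sr y hy)),
    fun y hy => by simp [hX y hy, hY y hy], fun y hy => by simp [hX y hy],
    fun y hy => (h_pos y hy).ne', dθ, dθ₁, dh, fun y hy => ?_⟩
  have hh : (h y : ℂ) ≠ 0 := by exact_mod_cast (h_pos y hy).ne'
  have hD := extD_add_conj_of_log hc.isOpen sκ sh (fun y hy => (h_pos y hy).ne') dh hy (X y) (Y y)
  -- Taking the real part in the definition of R loses nothing, because dκ(X, Y) is imaginary.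
  have hR : (R y : ℂ) = Complex.I * ((2 * (h y : ℂ))⁻¹ * extD κ y (X y) (Y y)) := by
    refine Complex.conj_eq_iff_re.1 ?_
    simp only [map_mul, map_inv₀, Complex.conj_I, Complex.conj_ofReal, map_ofNat]
    linear_combination (-Complex.I * (2 * (h y : ℂ))⁻¹) * hD
  rw [hR]
  simp only [wedge, bar_apply, hX y hy, hY y hy, Complex.conj_I, map_one]
  field_simp
  linear_combination (norm := (ring_nf; simp only [Complex.I_sq]; ring))

/-- Local existence of admissible coframes. -/
lemma exists_isCoframe (hc : IsContact Ω X Y θ) (hx : x ∈ Ω) :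
    ∃ Ω' ⊆ Ω, IsOpen Ω' ∧ x ∈ Ω' ∧ ∃ θ₁ κ h R A, IsCoframe Ω' X Y θ θ₁ κ h R A := by
  obtain ⟨e, he⟩ := hc.ne x hx
  have hcont : ContinuousOn (fun y => θ y e) Ω := fun y hy =>
    ((hc.smooth y hy).clm_apply contDiffAt_const).continuousAt.continuousWithinAt
  have hopen : IsOpen (Ω ∩ {y | θ y e ≠ 0}) :=
    hcont.isOpen_inter_preimage hc.isOpen isOpen_ne
  exact ⟨_, Set.inter_subset_left, hopen, ⟨hx, he⟩,
    (hc.mono hopen Set.inter_subset_left).exists_isCoframe_of_transverse fun y hy => hy.2⟩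

end IsContact

end LocalForm

/-! ### Change of the coframe data under θ' = e^u θ. -/

namespace LocalForm

open Filter Topology

variable {E : Type*} [NormedAddCommGroup E] [NormedSpace ℝ E]
variable {Ω : Set E} {X Y : E → E} {θ : E → E →L[ℝ] ℝ} {θ₁ κ θ₁' κ' : E → E →L[ℝ] ℂ}
  {h R h' R' u : E → ℝ} {A A' f k : E → ℂ} {x : E}

lemma extD_exp_smul (hu : ContDiffAt ℝ ∞ u x) (hθ : ContDiffAt ℝ ∞ θ x) (v w : E) :
    extD (fun y => Real.exp (u y) • θ y) x v w = Real.exp (u x) * (extD θ x v w +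
      (fderiv ℝ u x v * θ x w - fderiv ℝ u x w * θ x v)) := by
  have du := (hu.differentiableAt (by simp)).hasFDerivAt.exp
  rw [extD_smul du.differentiableAt (hθ.differentiableAt (by simp)), du.fderiv]
  simp
  ring

namespace IsCoframe

/-- On (X, Y) the term du ∧ θ of d(e^u θ) drops out, so the two Levi forms are compared directly. -/
lemma levi_transform (hc : IsContact Ω X Y θ) (hC : IsCoframe Ω X Y θ θ₁ κ h R A)
    (hC' : IsCoframe Ω X Y (fun y => Real.exp (u y) • θ y) θ₁' κ' h' R' A')
    (hu : ∀ x ∈ Ω, ContDiffAt ℝ ∞ u x)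
    (dec : ∀ x ∈ Ω, ∀ v, θ₁' x v = f x * θ₁ x v + k x * θ x v) (hx : x ∈ Ω) :
    ((Real.exp (u x) : ℝ) : ℂ) * h x = h' x * (f x * conj (f x)) := by
  have e1 := hC.dθ_eq x hx (X x) (Y x)
  have e2 := hC'.dθ_eq x hx (X x) (Y x)
  have hm := hC.ne x hx
  have hm' : conj (θ₁ x (X x)) ≠ 0 := by simpa using hm
  rw [extD_exp_smul (hu x hx) (hc.smooth x hx)] at e2
  simp only [hc.X_mem x hx, hc.Y_mem x hx, mul_zero, sub_zero, add_zero, wedge, bar_apply,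
    dec x hx, Complex.ofReal_zero, hC.type x hx, map_mul, Complex.conj_I, Complex.ofReal_mul]
    at e1 e2
  rw [e1] at e2
  refine mul_left_cancel₀ (mul_ne_zero hm hm') ?_
  linear_combination (norm := (ring_nf; simp only [Complex.I_sq]; ring)) (1 / 2) * e2

/-- Logarithmic derivative of the Levi form relation: log |h'| = u + log |h| - log |f|², where d log
|h| = κ + conj κ and likewise for κ'. -/
lemma conn_transform_real (hc : IsContact Ω X Y θ) (hC : IsCoframe Ω X Y θ θ₁ κ h R A)
    (hC' : IsCoframe Ω X Y (fun y => Real.exp (u y) • θ y) θ₁' κ' h' R' A')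
    (hu : ∀ x ∈ Ω, ContDiffAt ℝ ∞ u x) (hf : ∀ x ∈ Ω, ContDiffAt ℝ ∞ f x)
    (dec : ∀ x ∈ Ω, ∀ v, θ₁' x v = f x * θ₁ x v + k x * θ x v) (hx : x ∈ Ω) (v : E) :
    (κ' x v - κ x v + (f x)⁻¹ * fderiv ℝ f x v - (1 / 2) * (fderiv ℝ u x v : ℝ))
      + conj (κ' x v - κ x v + (f x)⁻¹ * fderiv ℝ f x v - (1 / 2) * (fderiv ℝ u x v : ℝ)) = 0 := by
  have levi := hC.levi_transform hc hC' hu dec hx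
  have hu' := ((hu x hx).differentiableAt (by simp)).hasFDerivAt.exp
  have dC (g : E → ℝ) (g' : E →L[ℝ] ℝ) (hg : HasFDerivAt g g' x) :
      HasFDerivAt (fun y => (g y : ℂ)) (Complex.ofRealCLM.comp g') x :=
    Complex.ofRealCLM.hasFDerivAt.comp x hg
  have dh := dC _ _ ((hC.h_smooth x hx).differentiableAt (by simp)).hasFDerivAt
  have dh' := dC _ _ ((hC'.h_smooth x hx).differentiableAt (by simp)).hasFDerivAt
  have df := ((hf x hx).differentiableAt (by simp)).hasFDerivAt
  have dfc : HasFDerivAt (fun y => conj (f y)) ((Complex.conjCLE : ℂ →L[ℝ] ℂ).comp (fderiv ℝ f x))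
    x := (Complex.conjCLE : ℂ →L[ℝ] ℂ).hasFDerivAt.comp x df
  have l := (dC _ _ hu').mul dh
  have r := dh'.mul (df.mul dfc)
  have := l.unique (r.congr_of_eventuallyEq (by
    filter_upwards [hc.isOpen.mem_nhds hx] with y hy
    exact hC.levi_transform hc hC' hu dec hy))
  have key := congrArg (fun L : E →L[ℝ] ℂ => L v) this
  have e1 := hC.dh_eq x hx v
  have e2 := hC'.dh_eq x hx v
  simp [← e1, ← e2, -Complex.ofReal_exp] at key
  have hh' : (h' x : ℂ) ≠ 0 := by exact_mod_cast hC'.h_ne x hx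
  have hh : (h x : ℂ) ≠ 0 := by exact_mod_cast hC.h_ne x hx
  have hE : ((Real.exp (u x) : ℝ) : ℂ) ≠ 0 := by exact_mod_cast (Real.exp_pos _).ne'
  have hff : f x * conj (f x) ≠ 0 := by
    intro h0
    rw [h0, mul_zero] at levi
    exact mul_ne_zero hE hh levi
  have hf0 := left_ne_zero_of_mul hff
  have hf1 := right_ne_zero_of_mul hff
  refine mul_left_cancel₀ hff ?_
  simp only [map_sub, map_add, map_mul, map_inv₀, map_div₀, map_one, map_ofNat,
    Complex.conj_ofReal]
  field_simp
  refine mul_left_cancel₀ hh' ?_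
  linear_combination (-2 : ℂ) * key + 2 * (κ x v + conj (κ x v) + (fderiv ℝ u x v : ℝ)) * levi

/-- The expression is imaginary by `conn_transform_real`, so its Z̄₁ component determines it on H.
That component comes from dθ¹' on (X, Y), once k is known from d(e^u θ) on pairs containing T. -/
lemma conn_transform (hc : IsContact Ω X Y θ) (hC : IsCoframe Ω X Y θ θ₁ κ h R A)
    (hC' : IsCoframe Ω X Y (fun y => Real.exp (u y) • θ y) θ₁' κ' h' R' A')
    (hu : ∀ x ∈ Ω, ContDiffAt ℝ ∞ u x) (hf : ∀ x ∈ Ω, ContDiffAt ℝ ∞ f x)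
    (hk : ∀ x ∈ Ω, ContDiffAt ℝ ∞ k x)
    (dec : ∀ x ∈ Ω, ∀ v, θ₁' x v = f x * θ₁ x v + k x * θ x v) (hx : x ∈ Ω) :
    (κ' x (X x) - κ x (X x) + (f x)⁻¹ * fderiv ℝ f x (X x) - (1 / 2) * (fderiv ℝ u x (X x) : ℝ)) =
      - (3 / 2) * Complex.I * (fderiv ℝ u x (Y x) : ℝ) ∧
    (κ' x (Y x) - κ x (Y x) + (f x)⁻¹ * fderiv ℝ f x (Y x) - (1 / 2) * (fderiv ℝ u x (Y x) : ℝ)) =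
      (3 / 2) * Complex.I * (fderiv ℝ u x (X x) : ℝ) := by
  have levi := hC.levi_transform hc hC' hu dec hx
  have rX := hC.conn_transform_real hc hC' hu hf dec hx (X x)
  have rY := hC.conn_transform_real hc hC' hu hf dec hx (Y x)
  obtain ⟨T, hT, hTX, hTY⟩ := hc.exists_reeb hx
  have h1T := hC.θ₁_reeb hx hTX hTY
  have hm := hC.ne x hx
  have hm' : conj (θ₁ x (X x)) ≠ 0 := by simpa using hm
  have hh' : (h' x : ℂ) ≠ 0 := by exact_mod_cast hC'.h_ne x hx
  have hh : (h x : ℂ) ≠ 0 := by exact_mod_cast hC.h_ne x hx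
  have hE : ((Real.exp (u x) : ℝ) : ℂ) ≠ 0 := by exact_mod_cast (Real.exp_pos _).ne'
  have hff : f x * conj (f x) ≠ 0 := by
    intro h0
    rw [h0, mul_zero] at levi
    exact mul_ne_zero hE hh levi
  have hf0 := left_ne_zero_of_mul hff
  have hf1 := right_ne_zero_of_mul hff
  have hθ := hc.smooth x hx
  -- the equation for the differential of the contact form, on pairs containing the Reeb field
  have eX := hC'.dθ_eq x hx (X x) T
  have eY := hC'.dθ_eq x hx (Y x) T
  rw [extD_exp_smul (hu x hx) hθ, extD_swap θ x T, hT] at eX eY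
  simp only [hTX, hTY, hT, hc.X_mem x hx, hc.Y_mem x hx, wedge, bar_apply, dec x hx,
    hC.type x hx, h1T, mul_zero, Complex.ofReal_zero, Complex.ofReal_one, mul_one, sub_zero,
    add_zero, zero_add, map_mul, Complex.conj_I, Complex.ofReal_mul, neg_zero] at eX eY
  have hk' : 2 * h' x * (k x * conj (f x) * conj (θ₁ x (X x))) = (Real.exp (u x) : ℝ) *
      (Complex.I * (fderiv ℝ u x (X x) : ℝ) - (fderiv ℝ u x (Y x) : ℝ)) := by
    linear_combination (norm := (ring_nf; simp only [Complex.I_sq]; ring)) eY - Complex.I * eX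
  -- the structure equation on the contact plane
  have hθ₁ := hC.θ₁_smooth x hx
  have e1 : extD θ₁' x (X x) (Y x) = extD (fun y => f y • θ₁ y + k y • toC θ y) x (X x) (Y x) := by
    refine extD_congr ?_ _ _
    filter_upwards [hc.isOpen.mem_nhds hx] with y hy
    ext v
    simp [dec y hy]
  have s1 : DifferentiableAt ℝ (fun y => f y • θ₁ y) x :=
    ((hf x hx).smul hθ₁).differentiableAt (by simp)
  have s2 : DifferentiableAt ℝ (fun y => k y • toC θ y) x :=
    ((hk x hx).smul (contDiffAt_toC hθ)).differentiableAt (by simp)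
  rw [extD_add s1 s2, extD_smul ((hf x hx).differentiableAt (by simp))
    (hθ₁.differentiableAt (by simp)), extD_smul ((hk x hx).differentiableAt (by simp))
    ((contDiffAt_toC hθ).differentiableAt (by simp)), extD_toC (hθ.differentiableAt (by simp)),
    hC'.dθ₁_eq x hx, hC.dθ₁_eq x hx, hC.dθ_eq x hx] at e1
  simp [wedge, hc.X_mem x hx, hc.Y_mem x hx, dec x hx, hC.type x hx] at e1
  -- The Levi form relation eliminates h'; k is thus f/h times a derivative of u along T^{0,1}, up
  -- to a constant factor.
  have hK : 2 * h x * k x * conj (θ₁ x (X x)) =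
      f x * (Complex.I * (fderiv ℝ u x (X x) : ℝ) - (fderiv ℝ u x (Y x) : ℝ)) := by
    refine mul_left_cancel₀ hE ?_
    linear_combination f x * hk' + 2 * k x * conj (θ₁ x (X x)) * levi
  set SX := κ' x (X x) - κ x (X x) + (f x)⁻¹ * fderiv ℝ f x (X x)
    - (1 / 2) * (fderiv ℝ u x (X x) : ℝ) with hSX
  set SY := κ' x (Y x) - κ x (Y x) + (f x)⁻¹ * fderiv ℝ f x (Y x)
    - (1 / 2) * (fderiv ℝ u x (Y x) : ℝ) with hSY
  -- The coefficient 3/2 is 1, from k dθ in dθ¹', plus 1/2, from the subtracted du/2.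
  have e2 : SY - Complex.I * SX = (3 / 2) *
      (Complex.I * (fderiv ℝ u x (X x) : ℝ) - (fderiv ℝ u x (Y x) : ℝ)) := by
    refine mul_left_cancel₀ hf0 ?_
    rw [hSX, hSY]
    field_simp
    refine mul_left_cancel₀ hm ?_
    linear_combination (norm := (ring_nf; simp only [Complex.I_sq]; ring))
      2 * e1 + 2 * θ₁ x (X x) * hK
  -- Together with the vanishing real parts, the equation and its conjugate can be solved for SX and
  -- SY.
  have e3 := congrArg conj e2
  simp only [map_sub, map_mul, map_div₀, map_ofNat, Complex.conj_I, Complex.conj_ofReal] at e3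
  constructor
  · linear_combination (norm := (ring_nf; simp only [Complex.I_sq]; ring))
      (Complex.I / 2) * e2 + (Complex.I / 2) * e3 + (1 / 2) * rX - (Complex.I / 2) * rY
  · linear_combination
      (1 / 2) * e2 - (1 / 2) * e3 + (1 / 2) * rY + (Complex.I / 2) * rX

end IsCoframe

end LocalForm

/-! ### The extension ζ of du ∘ J, and CR pluriharmonic functions. -/

namespace LocalForm

open Filter Topology

variable {E : Type*} [NormedAddCommGroup E] [NormedSpace ℝ E]
variable {Ω : Set E} {X Y : E → E} {θ : E → E →L[ℝ] ℝ} {θ₁ κ θ₁' κ' : E → E →L[ℝ] ℂ}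
  {h R h' R' u : E → ℝ} {A A' f k : E → ℂ} {x : E}

lemma IsContact.exp_smul (hc : IsContact Ω X Y θ) (hu : ∀ x ∈ Ω, ContDiffAt ℝ ∞ u x) :
    IsContact Ω X Y (fun y => Real.exp (u y) • θ y) where
  isOpen := hc.isOpen
  X_smooth := hc.X_smooth
  Y_smooth := hc.Y_smooth
  smooth x hx := (hu x hx).exp.smul (hc.smooth x hx)
  X_mem x hx := by simp [hc.X_mem x hx]
  Y_mem x hx := by simp [hc.Y_mem x hx]
  span x hx v hv := hc.span x hx v (by simpa [Real.exp_ne_zero] using hv)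
  pos x hx := by
    rw [extD_exp_smul (hu x hx) (hc.smooth x hx), hc.X_mem x hx, hc.Y_mem x hx]
    simpa using mul_pos (Real.exp_pos (u x)) (hc.pos x hx)
  ne x hx := by
    obtain ⟨e, he⟩ := hc.ne x hx
    exact ⟨e, by simpa [Real.exp_ne_zero] using he⟩

lemma IsContact.exists_transverse (hc : IsContact Ω X Y θ) (hx : x ∈ Ω) :
    ∃ Ω' ⊆ Ω, IsOpen Ω' ∧ x ∈ Ω' ∧ ∃ e, ∀ y ∈ Ω', θ y e ≠ 0 := by
  obtain ⟨e, he⟩ := hc.ne x hx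
  have hcont : ContinuousOn (fun y => θ y e) Ω := fun y hy =>
    ((hc.smooth y hy).clm_apply contDiffAt_const).continuousAt.continuousWithinAt
  exact ⟨_, Set.inter_subset_left, hcont.isOpen_inter_preimage hc.isOpen isOpen_ne, ⟨hx, he⟩,
    e, fun y hy => hy.2⟩

/-- `ζ` is a form restricting to `du ∘ J` on the contact planes. -/
structure IsConjugateForm (Ω : Set E) (X Y : E → E) (u : E → ℝ) (ζ : E → E →L[ℝ] ℂ) : Prop where
  smooth : ∀ x ∈ Ω, ContDiffAt ℝ ∞ ζ x
  apply_X : ∀ x ∈ Ω, ζ x (X x) = (fderiv ℝ u x (Y x) : ℝ)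
  apply_Y : ∀ x ∈ Ω, ζ x (Y x) = -(fderiv ℝ u x (X x) : ℝ)

/-- The form f⁻¹ df plays the role of d log f without a choice of branch. -/
lemma extD_inv_smul_fderiv (hf : ContDiffAt ℝ ∞ f x) (h0 : f x ≠ 0) (v w : E) :
    extD (fun y => (f y)⁻¹ • fderiv ℝ f y) x v w = 0 := by
  have df := (hf.differentiableAt (by simp)).hasFDerivAt
  have di : HasFDerivAt (fun y => (f y)⁻¹) _ x := (hasDerivAt_inv h0).comp_hasFDerivAt x df
  rw [extD_smul di.differentiableAt ((contDiffAt_fderiv hf).differentiableAt (by simp)), di.fderiv,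
    extD_fderiv hf]
  simp
  ring

lemma IsCoframe.contDiffAt_eta (hc : IsContact Ω X Y θ) (hC : IsCoframe Ω X Y θ θ₁ κ h R A)
    (hx : x ∈ Ω) : ContDiffAt ℝ ∞ (eta κ R θ) x :=
  (hC.κ_smooth x hx).add ((contDiffAt_const.mul (contDiffAt_ofReal (hC.R_smooth x hx))).smul
    (contDiffAt_toC (hc.smooth x hx)))

lemma contDiffAt_const_smul (c : ℂ) {α : E → E →L[ℝ] ℂ} (hα : ContDiffAt ℝ ∞ α x) :
    ContDiffAt ℝ ∞ (fun y => c • α y) x :=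
  (contDiffAt_const (c := c)).smul hα

/-- The difference η' - η is corrected by closed terms so that on H only the multiple of du ∘ J from
`conn_transform` survives. The factor 2i/3 normalizes that multiple to 1; the terms in R and R'
vanish on H. -/
lemma IsCoframe.exists_conjugateForm (hc : IsContact Ω X Y θ) (hC : IsCoframe Ω X Y θ θ₁ κ h R A)
    (hC' : IsCoframe Ω X Y (fun y => Real.exp (u y) • θ y) θ₁' κ' h' R' A')
    (hu : ∀ x ∈ Ω, ContDiffAt ℝ ∞ u x) {e : E} (he : ∀ x ∈ Ω, θ x e ≠ 0) :
    ∃ ζ, IsConjugateForm Ω X Y u ζ ∧ ∀ x ∈ Ω, ∀ v w, extD ζ x v w = (2 * Complex.I / 3) *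
      (extD (eta κ' R' (fun y => Real.exp (u y) • θ y)) x v w - extD (eta κ R θ) x v w) := by
  -- The coefficients of θ¹' = fθ¹ + kθ, read off at X and at the transverse vector e.
  let f : E → ℂ := fun y => (θ₁ y (X y))⁻¹ * θ₁' y (X y)
  let k : E → ℂ := fun y => ((θ y e : ℝ) : ℂ)⁻¹ * (θ₁' y e - f y * θ₁ y e)
  have hc' := hc.exp_smul hu
  have hf x (hx : x ∈ Ω) : ContDiffAt ℝ ∞ f x :=
    (((hC.θ₁_smooth x hx).clm_apply (hc.X_smooth x hx)).inv (hC.ne x hx)).mul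
      ((hC'.θ₁_smooth x hx).clm_apply (hc.X_smooth x hx))
  have f_ne x (hx : x ∈ Ω) : f x ≠ 0 := mul_ne_zero (inv_ne_zero (hC.ne x hx)) (hC'.ne x hx)
  have hk x (hx : x ∈ Ω) : ContDiffAt ℝ ∞ k x :=
    ((contDiffAt_ofReal ((hc.smooth x hx).clm_apply contDiffAt_const)).inv
      (by exact_mod_cast he x hx)).mul (((hC'.θ₁_smooth x hx).clm_apply contDiffAt_const).sub
        ((hf x hx).mul ((hC.θ₁_smooth x hx).clm_apply contDiffAt_const)))
  have dec x (hx : x ∈ Ω) v : θ₁' x v = f x * θ₁ x v + k x * θ x v := by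
    have hm := hC.ne x hx
    have hex : ((θ x e : ℝ) : ℂ) ≠ 0 := by exact_mod_cast he x hx
    have : θ₁' x = f x • θ₁ x + k x • toC θ x := by
      refine hc.clm_ext hx (he x hx) ?_ ?_ ?_
      · simp [f, hc.X_mem x hx]
        field_simp
      · simp [f, hc.Y_mem x hx, hC.type x hx, hC'.type x hx]
        field_simp
      · simp [k]
        field_simp
        ring
    rw [this]
    simp
  let ζ : E → E →L[ℝ] ℂ := fun y => (2 * Complex.I / 3) •
    (eta κ' R' (fun y => Real.exp (u y) • θ y) y - eta κ R θ y + (f y)⁻¹ • fderiv ℝ f y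
      - (1 / 2 : ℂ) • toC (fderiv ℝ u) y)
  have s1 x (hx : x ∈ Ω) := hC'.contDiffAt_eta hc' hx
  have s2 x (hx : x ∈ Ω) := hC.contDiffAt_eta hc hx
  have s3 x (hx : x ∈ Ω) : ContDiffAt ℝ ∞ (fun y => (f y)⁻¹ • fderiv ℝ f y) x :=
    ((hf x hx).inv (f_ne x hx)).smul (contDiffAt_fderiv (hf x hx))
  have s4 x (hx : x ∈ Ω) : ContDiffAt ℝ ∞ (toC (fderiv ℝ u)) x :=
    contDiffAt_toC (contDiffAt_fderiv (hu x hx))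
  refine ⟨ζ, ⟨fun x hx => ?_, fun x hx => ?_, fun x hx => ?_⟩, fun x hx v w => ?_⟩
  · exact contDiffAt_const_smul _ ((((s1 x hx).sub (s2 x hx)).add (s3 x hx)).sub
      (contDiffAt_const_smul _ (s4 x hx)))
  · have := (hC.conn_transform hc hC' hu hf hk dec hx).1
    simp [ζ, eta, hc.X_mem x hx]
    linear_combination (norm := (ring_nf; simp only [Complex.I_sq]; ring))
      (2 * Complex.I / 3) * this
  · have := (hC.conn_transform hc hC' hu hf hk dec hx).2
    simp [ζ, eta, hc.Y_mem x hx]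
    linear_combination (norm := (ring_nf; simp only [Complex.I_sq]; ring))
      (2 * Complex.I / 3) * this
  · have d {α : E → E →L[ℝ] ℂ} (hα : ContDiffAt ℝ ∞ α x) : DifferentiableAt ℝ α x :=
      hα.differentiableAt (by simp)
    have z (c : ℂ) {α : E → E →L[ℝ] ℂ} (hα : ContDiffAt ℝ ∞ α x) :
        extD (fun y => c • α y) x v w = c * extD α x v w := by
      rw [extD_smul (differentiableAt_const c) (d hα)]
      simp
    have t1 := (s1 x hx).sub (s2 x hx)
    have t2 := t1.add (s3 x hx)
    have t3 : ContDiffAt ℝ ∞ (fun y => (1 / 2 : ℂ) • toC (fderiv ℝ u) y) x :=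
      contDiffAt_const_smul _ (s4 x hx)
    rw [z _ (t2.sub t3), extD_sub (d t2) (d t3), extD_add (d t1) (d (s3 x hx)),
      extD_sub (d (s1 x hx)) (d (s2 x hx)), z _ (s4 x hx), extD_inv_smul_fderiv (hf x hx) (f_ne x hx),
      extD_toC ((contDiffAt_fderiv (hu x hx)).differentiableAt (by simp)), extD_fderiv (hu x hx)]
    simp

lemma fderiv_re_im {F : E → ℂ} (hF : ContDiffAt ℝ ∞ F x) (v : E) :
    fderiv ℝ F x v = (fderiv ℝ (fun y => (F y).re) x v : ℝ) +
      (fderiv ℝ (fun y => (F y).im) x v : ℝ) * Complex.I := by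
  have dF := (hF.differentiableAt (by simp)).hasFDerivAt
  have d1 : HasFDerivAt (fun y => (F y).re) (Complex.reCLM.comp (fderiv ℝ F x)) x :=
    Complex.reCLM.hasFDerivAt.comp x dF
  have d2 : HasFDerivAt (fun y => (F y).im) (Complex.imCLM.comp (fderiv ℝ F x)) x :=
    Complex.imCLM.hasFDerivAt.comp x dF
  rw [d1.fderiv, d2.fderiv]
  simp

/-- If `u` is the real part of a CR function `F`, then a form restricting to `du ∘ J` with
differential vanishing on the contact planes is closed (it is the differential of `-Im F`). -/
lemma IsConjugateForm.closed_of_isCR {ζ : E → E →L[ℝ] ℂ} (hζ : IsConjugateForm Ω X Y u ζ)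
    (hc : IsContact Ω X Y θ) (hd : ∀ x ∈ Ω, extD ζ x (X x) (Y x) = 0) {F : E → ℂ}
    (hF : ∀ x ∈ Ω, ContDiffAt ℝ ∞ F x)
    (hCR : ∀ x ∈ Ω, fderiv ℝ F x (X x) + Complex.I * fderiv ℝ F x (Y x) = 0)
    (hre : ∀ x ∈ Ω, u x = (F x).re) {e : E} (he : ∀ x ∈ Ω, θ x e ≠ 0) (hx : x ∈ Ω) (v w : E) :
    extD ζ x v w = 0 := by
  let g : E → ℝ := fun y => (F y).im
  have hg x (hx : x ∈ Ω) : ContDiffAt ℝ ∞ g x := Complex.imCLM.contDiff.contDiffAt.comp x (hF x hx)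
  have hu x (hx : x ∈ Ω) : fderiv ℝ (fun y => (F y).re) x = fderiv ℝ u x := by
    refine Filter.EventuallyEq.fderiv_eq ?_
    filter_upwards [hc.isOpen.mem_nhds hx] with y hy
    exact (hre y hy).symm
  have key x (hx : x ∈ Ω) : fderiv ℝ g x (X x) = - fderiv ℝ u x (Y x) ∧
      fderiv ℝ g x (Y x) = fderiv ℝ u x (X x) := by
    have := hCR x hx
    rw [fderiv_re_im (hF x hx), fderiv_re_im (hF x hx), hu x hx] at this
    have h1 := congrArg Complex.re this
    have h2 := congrArg Complex.im this
    simp at h1 h2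
    exact ⟨by linarith, by linarith⟩
  -- By the Cauchy–Riemann equations in `key`, ζ + dg vanishes on H, so it is a multiple of θ; μ is
  -- that multiple, read off at e.
  let μ : E → ℂ := fun y => ((θ y e : ℝ) : ℂ)⁻¹ * (ζ y e + (fderiv ℝ g y e : ℝ))
  have hμ x (hx : x ∈ Ω) : ContDiffAt ℝ ∞ μ x :=
    ((contDiffAt_ofReal ((hc.smooth x hx).clm_apply contDiffAt_const)).inv
      (by exact_mod_cast he x hx)).mul (((hζ.smooth x hx).clm_apply contDiffAt_const).add
        (contDiffAt_ofReal ((contDiffAt_fderiv (hg x hx)).clm_apply contDiffAt_const)))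
  have e1 x (hx : x ∈ Ω) : ζ x = μ x • toC θ x - toC (fderiv ℝ g) x := by
    have hex : ((θ x e : ℝ) : ℂ) ≠ 0 := by exact_mod_cast he x hx
    refine hc.clm_ext hx (he x hx) ?_ ?_ ?_
    · simp [hζ.apply_X x hx, hc.X_mem x hx, key x hx]
    · simp [hζ.apply_Y x hx, hc.Y_mem x hx, key x hx]
    · simp [μ]
      field_simp
      ring
  have e2 x (hx : x ∈ Ω) v w : extD ζ x v w = μ x * (extD θ x v w : ℝ)
      + (fderiv ℝ μ x v * θ x w - fderiv ℝ μ x w * θ x v) := by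
    have d1 := (contDiffAt_toC (hc.smooth x hx)).differentiableAt (n := ∞) (by simp)
    have d2 := (hμ x hx).differentiableAt (by simp)
    have d3 := contDiffAt_fderiv (hg x hx)
    have ev : ζ =ᶠ[𝓝 x] fun y => μ y • toC θ y - toC (fderiv ℝ g) y := by
      filter_upwards [hc.isOpen.mem_nhds hx] with y hy using e1 y hy
    have d4 : DifferentiableAt ℝ (fun y => μ y • toC θ y) x := d2.smul d1
    rw [extD_congr ev, extD_sub d4 ((contDiffAt_toC d3).differentiableAt (by simp)),
      extD_smul d2 d1, extD_toC ((hc.smooth x hx).differentiableAt (by simp)),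
      extD_toC (d3.differentiableAt (by simp)), extD_fderiv (hg x hx)]
    simp
  -- On (X, Y) the term dμ ∧ θ vanishes, leaving μ dθ(X, Y) = 0 with dθ(X, Y) > 0: here the
  -- nonintegrability of H enters.
  have hμ0 x (hx : x ∈ Ω) : μ x = 0 := by
    have := e2 x hx (X x) (Y x)
    rw [hd x hx, hc.X_mem x hx, hc.Y_mem x hx] at this
    have hp : ((extD θ x (X x) (Y x) : ℝ) : ℂ) ≠ 0 := by exact_mod_cast (hc.pos x hx).ne'
    simpa [hp] using this.symm
  have hμ' : fderiv ℝ μ x = 0 := by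
    have : μ =ᶠ[𝓝 x] fun _ => 0 := by
      filter_upwards [hc.isOpen.mem_nhds hx] with y hy using hμ0 y hy
    rw [this.fderiv_eq]
    simp
  rw [e2 x hx, hμ0 x hx, hμ']
  simp

/-- If `du ∘ J` extends to a closed form, then `u` is locally the real part of a CR function. -/
lemma IsConjugateForm.exists_isCR {ζ : E → E →L[ℝ] ℂ} (hζ : IsConjugateForm Ω X Y u ζ)
    (hΩ : IsOpen Ω) (hd : ∀ x ∈ Ω, ∀ v w, extD ζ x v w = 0) (hu : ∀ x ∈ Ω, ContDiffAt ℝ ∞ u x)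
    (hx : x ∈ Ω) : ∃ Ω' ⊆ Ω, IsOpen Ω' ∧ x ∈ Ω' ∧ ∃ F : E → ℂ, ∀ y ∈ Ω', ContDiffAt ℝ ∞ F y ∧
      fderiv ℝ F y (X y) + Complex.I * fderiv ℝ F y (Y y) = 0 ∧ u y = (F y).re := by
  obtain ⟨ε, hε, hB⟩ := Metric.isOpen_iff.1 hΩ x hx
  -- A primitive g of -Re ζ has g_X = -u_Y and g_Y = u_X, the equations for u + ig to be CR.
  let α : E → E →L[ℝ] ℝ := fun y => (-Complex.reCLM).comp (ζ y)
  have hα y (hy : y ∈ Ω) : ContDiffAt ℝ ∞ α y := contDiffAt_const.clm_comp (hζ.smooth y hy)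
  obtain ⟨g, hg⟩ : ∃ g, ∀ y ∈ Metric.ball x ε, HasFDerivAt g (α y) y :=
    (convex_ball x ε).exists_forall_hasFDerivAt_of_fderiv_symmetric Metric.isOpen_ball
    (fun y hy => ((hα y (hB hy)).differentiableAt (by simp)).differentiableWithinAt)
    (fun y hy v w => by
      have := extD_clm_comp (-Complex.reCLM) ((hζ.smooth y (hB hy)).differentiableAt (by simp)) v w
      rw [hd y (hB hy), map_zero] at this
      exact sub_eq_zero.1 this)
  have sg : ∀ y ∈ Metric.ball x ε, ContDiffAt ℝ ∞ g y := by
    have : ContDiffOn ℝ ∞ g (Metric.ball x ε) := by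
      rw [contDiffOn_infty_iff_fderiv_of_isOpen Metric.isOpen_ball]
      refine ⟨fun y hy => (hg y hy).differentiableAt.differentiableWithinAt, ?_⟩
      refine ContDiffOn.congr (f := α) (fun y hy => (hα y (hB hy)).contDiffWithinAt)
        fun y hy => (hg y hy).fderiv
    exact fun y hy => this.contDiffAt (Metric.isOpen_ball.mem_nhds hy)
  refine ⟨_, hB, Metric.isOpen_ball, Metric.mem_ball_self hε,
    fun y => (u y : ℂ) + (g y : ℂ) * Complex.I, fun y hy => ?_⟩
  have sF : ContDiffAt ℝ ∞ (fun y => (u y : ℂ) + (g y : ℂ) * Complex.I) y :=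
    (contDiffAt_ofReal (hu y (hB hy))).add ((contDiffAt_ofReal (sg y hy)).mul contDiffAt_const)
  refine ⟨sF, ?_, by simp⟩
  rw [fderiv_re_im sF, fderiv_re_im sF]
  simp [(hg y hy).fderiv, α, hζ.apply_X y (hB hy), hζ.apply_Y y (hB hy)]
  linear_combination (norm := (ring_nf; simp only [Complex.I_sq]; ring))

/-- If `θ` and `e^u θ` are pseudo-Einstein, then `u` is locally the real part of a CR function. -/
lemma IsCoframe.exists_isCR (hc : IsContact Ω X Y θ) (hC : IsCoframe Ω X Y θ θ₁ κ h R A)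
    (hC' : IsCoframe Ω X Y (fun y => Real.exp (u y) • θ y) θ₁' κ' h' R' A')
    (hu : ∀ x ∈ Ω, ContDiffAt ℝ ∞ u x) (hη : ∀ x ∈ Ω, ∀ v w, extD (eta κ R θ) x v w = 0)
    (hη' : ∀ x ∈ Ω, ∀ v w, extD (eta κ' R' (fun y => Real.exp (u y) • θ y)) x v w = 0)
    (hx : x ∈ Ω) : ∃ Ω' ⊆ Ω, IsOpen Ω' ∧ x ∈ Ω' ∧ ∃ F : E → ℂ, ∀ y ∈ Ω', ContDiffAt ℝ ∞ F y ∧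
      fderiv ℝ F y (X y) + Complex.I * fderiv ℝ F y (Y y) = 0 ∧ u y = (F y).re := by
  obtain ⟨Ω₁, hs, ho, hx₁, e, he⟩ := hc.exists_transverse hx
  obtain ⟨ζ, hζ, dζ⟩ := (hC.mono hs).exists_conjugateForm (hc.mono ho hs) (hC'.mono hs)
    (fun y hy => hu y (hs hy)) he
  obtain ⟨Ω', hs', H⟩ := hζ.exists_isCR ho (fun y hy v w => by
    rw [dζ y hy, hη y (hs hy), hη' y (hs hy)]; simp) (fun y hy => hu y (hs hy)) hx₁
  exact ⟨Ω', hs'.trans hs, H⟩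

/-- If `θ` is pseudo-Einstein and `u` is the real part of a CR function, then `e^u θ` is
pseudo-Einstein. -/
lemma IsCoframe.closed_of_isCR (hc : IsContact Ω X Y θ) (hC : IsCoframe Ω X Y θ θ₁ κ h R A)
    (hC' : IsCoframe Ω X Y (fun y => Real.exp (u y) • θ y) θ₁' κ' h' R' A')
    (hu : ∀ x ∈ Ω, ContDiffAt ℝ ∞ u x) (hη : ∀ x ∈ Ω, ∀ v w, extD (eta κ R θ) x v w = 0)
    {F : E → ℂ} (hF : ∀ y ∈ Ω, ContDiffAt ℝ ∞ F y ∧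
      fderiv ℝ F y (X y) + Complex.I * fderiv ℝ F y (Y y) = 0 ∧ u y = (F y).re)
    (hx : x ∈ Ω) (v w : E) :
    extD (eta κ' R' (fun y => Real.exp (u y) • θ y)) x v w = 0 := by
  obtain ⟨Ω₁, hs, ho, hx₁, e, he⟩ := hc.exists_transverse hx
  obtain ⟨ζ, hζ, dζ⟩ := (hC.mono hs).exists_conjugateForm (hc.mono ho hs) (hC'.mono hs)
    (fun y hy => hu y (hs hy)) he
  -- Only dζ(X, Y) = 0 is required, and this holds for every pair of coframes, before η' is known to
  -- be closed.
  have := hζ.closed_of_isCR (hc.mono ho hs) (fun y hy => by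
    rw [dζ y hy, hC'.extD_eta_frame (hc.exp_smul hu) (hs hy), hC.extD_eta_frame hc (hs hy)]
    simp) (fun y hy => (hF y (hs hy)).1) (fun y hy => (hF y (hs hy)).2.1)
    (fun y hy => (hF y (hs hy)).2.2) he hx₁ v w
  rw [dζ x hx₁, hη x hx, sub_zero] at this
  simpa using this

end LocalForm

/-! ### One-forms, functions and vector fields on the manifold, read in charts. -/

namespace OneForm

open Filter Topology LocalForm

variable {M : Type*} [TopologicalSpace M] [ChartedSpace (EuclideanSpace ℝ (Fin 3)) M]
  {F : Type*} [NormedAddCommGroup F] [NormedSpace ℝ F]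

/-- The derivative at `q` of the preferred chart at `p`. -/
def chartDeriv (p q : M) : TangentSpace (𝓡 3) q →L[ℝ] EuclideanSpace ℝ (Fin 3) :=
  mfderiv (𝓡 3) 𝓘(ℝ, EuclideanSpace ℝ (Fin 3)) (extChartAt (𝓡 3) p) q

/-- The derivative at `y` of the inverse of the preferred chart at `p`. -/
def chartSymmDeriv (p : M) (y : EuclideanSpace ℝ (Fin 3)) :
    EuclideanSpace ℝ (Fin 3) →L[ℝ] TangentSpace (𝓡 3) ((extChartAt (𝓡 3) p).symm y) :=
  mfderiv 𝓘(ℝ, EuclideanSpace ℝ (Fin 3)) (𝓡 3) (extChartAt (𝓡 3) p).symm y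

/-- The transition function between the preferred charts at `p` and `p'`. -/
def transition (p p' : M) (y : EuclideanSpace ℝ (Fin 3)) : EuclideanSpace ℝ (Fin 3) :=
  extChartAt (𝓡 3) p' ((extChartAt (𝓡 3) p).symm y)

/-- The one-form on the chart domain defined by its coordinate representation. -/
def pull (p : M) (β : EuclideanSpace ℝ (Fin 3) → EuclideanSpace ℝ (Fin 3) →L[ℝ] F) : OneForm M F :=
  fun q => (β (extChartAt (𝓡 3) p q)).comp (chartDeriv p q)

variable {α : OneForm M F} {p p' q : M} {y : EuclideanSpace ℝ (Fin 3)}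

lemma inChart_apply (α : OneForm M F) (p : M) (y v : EuclideanSpace ℝ (Fin 3)) :
    α.inChart p y v = α ((extChartAt (𝓡 3) p).symm y) (chartSymmDeriv p y v) := rfl

lemma pull_apply (p q : M) (β : EuclideanSpace ℝ (Fin 3) → EuclideanSpace ℝ (Fin 3) →L[ℝ] F)
    (v : TangentSpace (𝓡 3) q) :
    pull p β q v = β (extChartAt (𝓡 3) p q) (chartDeriv p q v) := rfl

variable [IsManifold (𝓡 3) ∞ M]

lemma chartDeriv_chartSymmDeriv (hy : y ∈ (extChartAt (𝓡 3) p).target)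
    (v : EuclideanSpace ℝ (Fin 3)) :
    chartDeriv p ((extChartAt (𝓡 3) p).symm y) (chartSymmDeriv p y v) = v := by
  have := mfderiv_extChartAt_comp_mfderivWithin_extChartAt_symm (I := 𝓡 3) hy
  rw [ModelWithCorners.range_eq_univ, mfderivWithin_univ] at this
  exact congrArg (fun L => L v) this

lemma chartSymmDeriv_chartDeriv (hy : y ∈ (extChartAt (𝓡 3) p).target)
    (v : TangentSpace (𝓡 3) ((extChartAt (𝓡 3) p).symm y)) :
    chartSymmDeriv p y (chartDeriv p ((extChartAt (𝓡 3) p).symm y) v) = v := by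
  have := mfderivWithin_extChartAt_symm_comp_mfderiv_extChartAt (I := 𝓡 3) hy
  rw [ModelWithCorners.range_eq_univ, mfderivWithin_univ] at this
  exact congrArg (fun L => L v) this

lemma inChart_chartDeriv (α : OneForm M F) (hq : q ∈ (extChartAt (𝓡 3) p).source)
    (v : TangentSpace (𝓡 3) q) :
    α.inChart p (extChartAt (𝓡 3) p q) (chartDeriv p q v) = α q v := by
  have hy := (extChartAt (𝓡 3) p).map_source hq
  have hq' := (extChartAt (𝓡 3) p).left_inv hq
  -- The type of the tangent vector depends on its base point, so q is replaced by the inverse chart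
  -- applied to y throughout.
  generalize extChartAt (𝓡 3) p q = y at hy hq'
  subst hq'
  rw [inChart_apply, chartSymmDeriv_chartDeriv hy]

lemma inChart_pull (β : EuclideanSpace ℝ (Fin 3) → EuclideanSpace ℝ (Fin 3) →L[ℝ] F)
    (hy : y ∈ (extChartAt (𝓡 3) p).target) : (pull p β).inChart p y = β y := by
  ext v
  rw [inChart_apply, pull_apply, chartDeriv_chartSymmDeriv hy, (extChartAt (𝓡 3) p).right_inv hy]

lemma contDiffAt_transition (hy : y ∈ (extChartAt (𝓡 3) p).target)
    (hq : (extChartAt (𝓡 3) p).symm y ∈ (extChartAt (𝓡 3) p').source) :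
    ContDiffAt ℝ ∞ (transition p p') y := by
  rw [← contMDiffAt_iff_contDiffAt]
  have h1 : ContMDiffAt 𝓘(ℝ, EuclideanSpace ℝ (Fin 3)) (𝓡 3) ∞ (extChartAt (𝓡 3) p).symm y :=
    (contMDiffOn_extChartAt_symm p).contMDiffAt ((isOpen_extChartAt_target p).mem_nhds hy)
  exact (contMDiffAt_extChartAt' (by simpa using hq)).comp y h1

lemma fderiv_transition (hy : y ∈ (extChartAt (𝓡 3) p).target)
    (hq : (extChartAt (𝓡 3) p).symm y ∈ (extChartAt (𝓡 3) p').source)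
    (v : EuclideanSpace ℝ (Fin 3)) : fderiv ℝ (transition p p') y v =
      chartDeriv p' ((extChartAt (𝓡 3) p).symm y) (chartSymmDeriv p y v) := by
  have h1 : MDifferentiableAt 𝓘(ℝ, EuclideanSpace ℝ (Fin 3)) (𝓡 3) (extChartAt (𝓡 3) p).symm y :=
    ((contMDiffOn_extChartAt_symm (n := ∞) p).contMDiffAt
      ((isOpen_extChartAt_target p).mem_nhds hy)).mdifferentiableAt (by simp)
  have h2 : MDifferentiableAt (𝓡 3) 𝓘(ℝ, EuclideanSpace ℝ (Fin 3)) (extChartAt (𝓡 3) p')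
      ((extChartAt (𝓡 3) p).symm y) := mdifferentiableAt_extChartAt (by simpa using hq)
  have := mfderiv_comp y h2 h1
  rw [← mfderiv_eq_fderiv]
  exact congrArg (fun L => L v) this

lemma inChart_eq_transition (α : OneForm M F) (hy : y ∈ (extChartAt (𝓡 3) p).target)
    (hq : (extChartAt (𝓡 3) p).symm y ∈ (extChartAt (𝓡 3) p').source) :
    α.inChart p y = (α.inChart p' (transition p p' y)).comp (fderiv ℝ (transition p p') y) := by
  ext v
  rw [inChart_apply, ContinuousLinearMap.comp_apply, fderiv_transition hy hq, transition,
    inChart_chartDeriv α hq]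

lemma eventually_inChart_eq_transition (α : OneForm M F) (hy : y ∈ (extChartAt (𝓡 3) p).target)
    (hq : (extChartAt (𝓡 3) p).symm y ∈ (extChartAt (𝓡 3) p').source) :
    α.inChart p =ᶠ[𝓝 y]
      fun z => (α.inChart p' (transition p p' z)).comp (fderiv ℝ (transition p p') z) := by
  have ho := (continuousOn_extChartAt_symm (I := 𝓡 3) p).isOpen_inter_preimage
    (isOpen_extChartAt_target p) (isOpen_extChartAt_source (I := 𝓡 3) p')
  filter_upwards [ho.mem_nhds ⟨hy, hq⟩] with z hz using inChart_eq_transition α hz.1 hz.2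

lemma contDiffAt_inChart_of_mem (hq : q ∈ (extChartAt (𝓡 3) p).source)
    (hq' : q ∈ (extChartAt (𝓡 3) p').source)
    (h : ContDiffAt ℝ ∞ (α.inChart p') (extChartAt (𝓡 3) p' q)) :
    ContDiffAt ℝ ∞ (α.inChart p) (extChartAt (𝓡 3) p q) := by
  have hy := (extChartAt (𝓡 3) p).map_source hq
  have hs := (extChartAt (𝓡 3) p).left_inv hq
  have hq'' : (extChartAt (𝓡 3) p).symm (extChartAt (𝓡 3) p q) ∈ (extChartAt (𝓡 3) p').source := by
    rwa [hs]
  have ht : transition p p' (extChartAt (𝓡 3) p q) = extChartAt (𝓡 3) p' q := by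
    rw [transition, hs]
  have s := contDiffAt_transition hy hq''
  rw [← ht] at h
  exact ((h.comp _ s).clm_comp (contDiffAt_fderiv s)).congr_of_eventuallyEq
    (eventually_inChart_eq_transition α hy hq'')

lemma SmoothOn.contDiffAt {U : Set M} (h : α.SmoothOn U) (hq : q ∈ U)
    (hp : q ∈ (extChartAt (𝓡 3) p).source) :
    ContDiffAt ℝ ∞ (α.inChart p) (extChartAt (𝓡 3) p q) :=
  contDiffAt_inChart_of_mem hp (mem_extChartAt_source q) (h q hq)

lemma SmoothOn.contDiffAt' {U : Set M} (h : α.SmoothOn U)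
    (hy : y ∈ (extChartAt (𝓡 3) p).target) (hq : (extChartAt (𝓡 3) p).symm y ∈ U) :
    ContDiffAt ℝ ∞ (α.inChart p) y := by
  have := h.contDiffAt hq ((extChartAt (𝓡 3) p).map_target hy)
  rwa [(extChartAt (𝓡 3) p).right_inv hy] at this

/-- The exterior derivative can be computed in any preferred chart. -/
lemma d_eq_extD (hp : q ∈ (extChartAt (𝓡 3) p).source)
    (h : ContDiffAt ℝ ∞ (α.inChart p) (extChartAt (𝓡 3) p q)) (v w : TangentSpace (𝓡 3) q) :
    α.d q v w = extD (α.inChart p) (extChartAt (𝓡 3) p q) (chartDeriv p q v) (chartDeriv p q w) := by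
  change extD (α.inChart q) (extChartAt (𝓡 3) q q) (chartDeriv q q v) (chartDeriv q q w) = _
  have hq := mem_extChartAt_source (I := 𝓡 3) q
  have hy := (extChartAt (𝓡 3) q).map_source hq
  have hs := (extChartAt (𝓡 3) q).left_inv hq
  have hq' : (extChartAt (𝓡 3) q).symm (extChartAt (𝓡 3) q q) ∈ (extChartAt (𝓡 3) p).source := by
    rwa [hs]
  have ht : transition q p (extChartAt (𝓡 3) q q) = extChartAt (𝓡 3) p q := by
    rw [transition, hs]
  have key (v : TangentSpace (𝓡 3) q) :
      fderiv ℝ (transition q p) (extChartAt (𝓡 3) q q) (chartDeriv q q v) = chartDeriv p q v := by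
    have h1 : MDifferentiableAt (𝓡 3) 𝓘(ℝ, EuclideanSpace ℝ (Fin 3)) (extChartAt (𝓡 3) q) q :=
      mdifferentiableAt_extChartAt (by simp)
    have h2 : MDifferentiableAt 𝓘(ℝ, EuclideanSpace ℝ (Fin 3)) 𝓘(ℝ, EuclideanSpace ℝ (Fin 3))
        (transition q p) (extChartAt (𝓡 3) q q) :=
      ((contDiffAt_transition hy hq').differentiableAt (by simp)).mdifferentiableAt
    have := mfderiv_comp q h2 h1
    rw [mfderiv_eq_fderiv] at this
    have e : (transition q p ∘ extChartAt (𝓡 3) q) =ᶠ[𝓝 q] extChartAt (𝓡 3) p := by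
      filter_upwards [(isOpen_extChartAt_source (I := 𝓡 3) q).mem_nhds hq] with z hz
      simp only [Function.comp_apply, transition, (extChartAt (𝓡 3) q).left_inv hz]
    rw [e.mfderiv_eq] at this
    exact (congrArg (fun L => L v) this).symm
  rw [extD_congr (eventually_inChart_eq_transition α hy hq'), extD_pullback
    (contDiffAt_transition hy hq') (by rw [ht]; exact h.differentiableAt (by simp)), ht, key, key]

lemma contDiffAt_comp_symm {f : M → F} (hy : y ∈ (extChartAt (𝓡 3) p).target)
    (hf : ContMDiffAt (𝓡 3) 𝓘(ℝ, F) ∞ f ((extChartAt (𝓡 3) p).symm y)) :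
    ContDiffAt ℝ ∞ (fun y => f ((extChartAt (𝓡 3) p).symm y)) y := by
  rw [← contMDiffAt_iff_contDiffAt]
  have h1 : ContMDiffAt 𝓘(ℝ, EuclideanSpace ℝ (Fin 3)) (𝓡 3) ∞ (extChartAt (𝓡 3) p).symm y :=
    (contMDiffOn_extChartAt_symm p).contMDiffAt ((isOpen_extChartAt_target p).mem_nhds hy)
  exact hf.comp y h1

lemma oneFormOf_apply {f : M → F} (hp : q ∈ (extChartAt (𝓡 3) p).source)
    (hf : ContMDiffAt (𝓡 3) 𝓘(ℝ, F) ∞ f q) (v : TangentSpace (𝓡 3) q) :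
    oneFormOf f q v = fderiv ℝ (fun y => f ((extChartAt (𝓡 3) p).symm y)) (extChartAt (𝓡 3) p q)
      (chartDeriv p q v) := by
  have h1 : MDifferentiableAt (𝓡 3) 𝓘(ℝ, EuclideanSpace ℝ (Fin 3)) (extChartAt (𝓡 3) p) q :=
    mdifferentiableAt_extChartAt (by simpa using hp)
  have hs := (extChartAt (𝓡 3) p).left_inv hp
  have h2 : MDifferentiableAt 𝓘(ℝ, EuclideanSpace ℝ (Fin 3)) 𝓘(ℝ, F)
      (fun y => f ((extChartAt (𝓡 3) p).symm y)) (extChartAt (𝓡 3) p q) :=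
    ((contDiffAt_comp_symm ((extChartAt (𝓡 3) p).map_source hp)
      (by rwa [hs])).differentiableAt (by simp)).mdifferentiableAt
  have := mfderiv_comp q h2 h1
  rw [mfderiv_eq_fderiv] at this
  have e : ((fun y => f ((extChartAt (𝓡 3) p).symm y)) ∘ extChartAt (𝓡 3) p) =ᶠ[𝓝 q] f := by
    filter_upwards [(isOpen_extChartAt_source (I := 𝓡 3) p).mem_nhds hp] with z hz
    simp only [Function.comp_apply, (extChartAt (𝓡 3) p).left_inv hz]
  rw [e.mfderiv_eq] at this
  exact congrArg (fun L => L v) this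

lemma contMDiffAt_comp_extChartAt {g : EuclideanSpace ℝ (Fin 3) → F}
    (hp : q ∈ (extChartAt (𝓡 3) p).source) (hg : ContDiffAt ℝ ∞ g (extChartAt (𝓡 3) p q)) :
    ContMDiffAt (𝓡 3) 𝓘(ℝ, F) ∞ (fun q => g (extChartAt (𝓡 3) p q)) q :=
  ContMDiffAt.comp q hg.contMDiffAt (contMDiffAt_extChartAt' (by simpa using hp))

/-- Smoothness of a section is smoothness in the trivialization of the tangent bundle at p, whose
fibre map is the derivative of the chart at p. -/
lemma contDiffAt_vectorField {V : (q : M) → TangentSpace (𝓡 3) q} {U : Set M} (hU : IsOpen U)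
    (hV : ContMDiffOn (𝓡 3) (𝓡 3).tangent ∞
      (fun q => (⟨q, V q⟩ : TangentBundle (𝓡 3) M)) U)
    (hy : y ∈ (extChartAt (𝓡 3) p).target) (hq : (extChartAt (𝓡 3) p).symm y ∈ U) :
    ContDiffAt ℝ ∞ (fun y => chartDeriv p ((extChartAt (𝓡 3) p).symm y)
      (V ((extChartAt (𝓡 3) p).symm y))) y := by
  have hs := (extChartAt (𝓡 3) p).map_target hy
  rw [extChartAt_source] at hs
  let e := trivializationAt (EuclideanSpace ℝ (Fin 3)) (TangentSpace (𝓡 3) (M := M)) p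
  have h1 := (e.contMDiffAt_section_iff hs).1 ((hV _ hq).contMDiffAt (hU.mem_nhds hq))
  refine (contDiffAt_comp_symm hy h1).congr_of_eventuallyEq ?_
  filter_upwards [(isOpen_extChartAt_target p).mem_nhds hy] with z hz
  have hz' := (extChartAt (𝓡 3) p).map_target hz
  rw [extChartAt_source] at hz'
  have h2 := TangentBundle.continuousLinearMapAt_trivializationAt (I := 𝓡 3) hz'
  have h3 := congrArg (fun L => L (V ((extChartAt (𝓡 3) p).symm z))) h2
  refine h3.symm.trans ?_
  exact Bundle.Trivialization.continuousLinearMapAt_apply_of_mem (R := ℝ) e hz' _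

end OneForm

/-! ### Dictionary between the manifold and one fixed chart. -/

namespace OneForm

open Filter Topology LocalForm

variable {M : Type*} [TopologicalSpace M] [ChartedSpace (EuclideanSpace ℝ (Fin 3)) M]

/-- The part of a set in the domain of the preferred chart at `p`, in coordinates. -/
def chartSet (p : M) (U : Set M) : Set (EuclideanSpace ℝ (Fin 3)) :=
  (extChartAt (𝓡 3) p).target ∩ (extChartAt (𝓡 3) p).symm ⁻¹' U

lemma isOpen_chartSet (p : M) {U : Set M} (hU : IsOpen U) : IsOpen (chartSet p U) :=
  (continuousOn_extChartAt_symm p).isOpen_inter_preimage (isOpen_extChartAt_target p) hU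

lemma mem_chartSet {p q : M} {U : Set M} (hp : q ∈ (extChartAt (𝓡 3) p).source) (hq : q ∈ U) :
    extChartAt (𝓡 3) p q ∈ chartSet p U :=
  ⟨(extChartAt (𝓡 3) p).map_source hp, by rwa [Set.mem_preimage, (extChartAt (𝓡 3) p).left_inv hp]⟩

/-- The coordinate representation of a vector field. -/
def vecInChart (p : M) (V : (q : M) → TangentSpace (𝓡 3) q) (y : EuclideanSpace ℝ (Fin 3)) :
    EuclideanSpace ℝ (Fin 3) :=
  chartDeriv p ((extChartAt (𝓡 3) p).symm y) (V ((extChartAt (𝓡 3) p).symm y))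

lemma vecInChart_extChartAt {p q : M} (hq : q ∈ (extChartAt (𝓡 3) p).source)
    (V : (q : M) → TangentSpace (𝓡 3) q) :
    vecInChart p V (extChartAt (𝓡 3) p q) = chartDeriv p q (V q) := by
  have hq' := (extChartAt (𝓡 3) p).left_inv hq
  generalize extChartAt (𝓡 3) p q = y at hq'
  subst hq'
  rfl

variable [IsManifold (𝓡 3) ∞ M] {F : Type*} [NormedAddCommGroup F] [NormedSpace ℝ F]
  {α : OneForm M F} {p q : M} {y : EuclideanSpace ℝ (Fin 3)}

lemma inChart_chartDeriv_symm (α : OneForm M F) (hy : y ∈ (extChartAt (𝓡 3) p).target)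
    (v : TangentSpace (𝓡 3) ((extChartAt (𝓡 3) p).symm y)) :
    α.inChart p y (chartDeriv p ((extChartAt (𝓡 3) p).symm y) v) =
      α ((extChartAt (𝓡 3) p).symm y) v := by
  rw [inChart_apply, chartSymmDeriv_chartDeriv hy]

lemma extD_inChart_chartDeriv (hy : y ∈ (extChartAt (𝓡 3) p).target)
    (h : ContDiffAt ℝ ∞ (α.inChart p) y)
    (v w : TangentSpace (𝓡 3) ((extChartAt (𝓡 3) p).symm y)) :
    extD (α.inChart p) y (chartDeriv p ((extChartAt (𝓡 3) p).symm y) v)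
      (chartDeriv p ((extChartAt (𝓡 3) p).symm y) w) = α.d ((extChartAt (𝓡 3) p).symm y) v w := by
  have hr := (extChartAt (𝓡 3) p).right_inv hy
  rw [d_eq_extD ((extChartAt (𝓡 3) p).map_target hy) (by rwa [hr]), hr]

lemma extD_inChart (hy : y ∈ (extChartAt (𝓡 3) p).target)
    (h : ContDiffAt ℝ ∞ (α.inChart p) y) (v w : EuclideanSpace ℝ (Fin 3)) :
    extD (α.inChart p) y v w =
      α.d ((extChartAt (𝓡 3) p).symm y) (chartSymmDeriv p y v) (chartSymmDeriv p y w) := by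
  rw [← extD_inChart_chartDeriv hy h, chartDeriv_chartSymmDeriv hy, chartDeriv_chartSymmDeriv hy]

lemma fderiv_comp_symm {f : M → F} (hy : y ∈ (extChartAt (𝓡 3) p).target)
    (hf : ContMDiffAt (𝓡 3) 𝓘(ℝ, F) ∞ f ((extChartAt (𝓡 3) p).symm y))
    (v : EuclideanSpace ℝ (Fin 3)) :
    fderiv ℝ (fun y => f ((extChartAt (𝓡 3) p).symm y)) y v =
      oneFormOf f ((extChartAt (𝓡 3) p).symm y) (chartSymmDeriv p y v) := by
  rw [oneFormOf_apply ((extChartAt (𝓡 3) p).map_target hy) hf, (extChartAt (𝓡 3) p).right_inv hy,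
    chartDeriv_chartSymmDeriv hy]

lemma contDiffAt_inChart_pull {β : EuclideanSpace ℝ (Fin 3) → EuclideanSpace ℝ (Fin 3) →L[ℝ] F}
    (hy : y ∈ (extChartAt (𝓡 3) p).target) (h : ContDiffAt ℝ ∞ β y) :
    ContDiffAt ℝ ∞ ((pull p β).inChart p) y := by
  refine h.congr_of_eventuallyEq ?_
  filter_upwards [(isOpen_extChartAt_target p).mem_nhds hy] with z hz using inChart_pull β hz

lemma smoothOn_pull {β : EuclideanSpace ℝ (Fin 3) → EuclideanSpace ℝ (Fin 3) →L[ℝ] F} {U : Set M}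
    (hU : U ⊆ (extChartAt (𝓡 3) p).source)
    (h : ∀ q ∈ U, ContDiffAt ℝ ∞ β (extChartAt (𝓡 3) p q)) : (pull p β).SmoothOn U :=
  fun q hq => contDiffAt_inChart_of_mem (mem_extChartAt_source q) (hU hq)
    (contDiffAt_inChart_pull ((extChartAt (𝓡 3) p).map_source (hU hq)) (h q hq))

lemma d_pull {β : EuclideanSpace ℝ (Fin 3) → EuclideanSpace ℝ (Fin 3) →L[ℝ] F}
    (hq : q ∈ (extChartAt (𝓡 3) p).source) (h : ContDiffAt ℝ ∞ β (extChartAt (𝓡 3) p q))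
    (v w : TangentSpace (𝓡 3) q) : (pull p β).d q v w =
      extD β (extChartAt (𝓡 3) p q) (chartDeriv p q v) (chartDeriv p q w) := by
  have hy := (extChartAt (𝓡 3) p).map_source hq
  rw [d_eq_extD hq (contDiffAt_inChart_pull hy h)]
  refine extD_congr ?_ _ _
  filter_upwards [(isOpen_extChartAt_target p).mem_nhds hy] with z hz using inChart_pull β hz

end OneForm

/-! ### Contact forms and admissible coframes of a CR structure in a chart. -/

namespace CRStructure

open Filter Topology LocalForm OneForm

variable {M : Type*} [TopologicalSpace M] [ChartedSpace (EuclideanSpace ℝ (Fin 3)) M]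
  [IsManifold (𝓡 3) ∞ M] {S : CRStructure M} {θ : OneForm M ℝ} {p q : M}
  {y : EuclideanSpace ℝ (Fin 3)}

lemma exists_eq_smul_add_smul_J (S : CRStructure M) {p : M} {X : S.H p} (hX : X ≠ 0) (v : S.H p) :
    ∃ a b : ℝ, v = a • X + b • S.J p X := by
  have hli : LinearIndependent ℝ ![X, S.J p X] := by
    rw [LinearIndependent.pair_iff]
    intro a b h
    have h' := congrArg (S.J p) h
    simp only [map_add, map_smul, S.J_sq, map_zero] at h'
    -- Apply aI - bJ to aX + bJX = 0 and use J² = -1.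
    have : (a ^ 2 + b ^ 2) • X = 0 := by
      calc (a ^ 2 + b ^ 2) • X = a • (a • X + b • S.J p X) - b • (a • S.J p X + b • -X) := by module
        _ = 0 := by rw [h, h']; simp
    have h2 := (smul_eq_zero.1 this).resolve_right hX
    constructor <;> nlinarith [sq_nonneg a, sq_nonneg b]
  have hspan := hli.span_eq_top_of_card_eq_finrank (by simp [S.finrank_H p])
  have hv : v ∈ Submodule.span ℝ (Set.range ![X, S.J p X]) := by rw [hspan]; trivial
  rw [Matrix.range_cons, Matrix.range_cons, Matrix.range_empty, Set.union_empty,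
    Set.singleton_union, Submodule.mem_span_pair] at hv
  obtain ⟨a, b, h⟩ := hv
  exact ⟨a, b, h.symm⟩

/-- Where θ vanishes, its kernel would be the whole tangent space, of dimension 3 instead of 2. -/
lemma exists_ne_zero (S : CRStructure M) (hθ : S.IsContactForm θ) (p : M) : ∃ v, θ p v ≠ 0 := by
  by_contra! h
  have htop : S.H p = ⊤ := by
    ext v
    simp [hθ.ker_eq p v, h v]
  have h1 := S.finrank_H p
  rw [htop, finrank_top] at h1
  have h2 : Module.finrank ℝ (TangentSpace (𝓡 3) p) = 3 :=
    finrank_euclideanSpace_fin (𝕜 := ℝ) (n := 3)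
  omega

/-- A local frame `X, J X` of the plane field. -/
structure Frame (S : CRStructure M) where
  /-- the domain -/
  U : Set M
  isOpen_U : IsOpen U
  /-- the first vector field -/
  X : (q : M) → S.H q
  ne_zero : ∀ q ∈ U, X q ≠ 0
  smooth : ContMDiffOn (𝓡 3) (𝓡 3).tangent ∞
      (fun q => (⟨q, (X q : TangentSpace (𝓡 3) q)⟩ : TangentBundle (𝓡 3) M)) U
  smooth_J : ContMDiffOn (𝓡 3) (𝓡 3).tangent ∞
      (fun q => (⟨q, (S.J q (X q) : TangentSpace (𝓡 3) q)⟩ : TangentBundle (𝓡 3) M)) U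

lemma exists_frame (S : CRStructure M) (p : M) : ∃ Φ : S.Frame, p ∈ Φ.U := by
  obtain ⟨U, hU, hp, X, h1, h2, h3⟩ := S.smooth p
  exact ⟨⟨U, hU, X, h1, h2, h3⟩, hp⟩

/-- The first vector field of the frame in the preferred chart at `p`. -/
def Frame.X' (Φ : S.Frame) (p : M) : EuclideanSpace ℝ (Fin 3) → EuclideanSpace ℝ (Fin 3) :=
  vecInChart p fun q => (Φ.X q : TangentSpace (𝓡 3) q)

/-- The second vector field of the frame in the preferred chart at `p`. -/
def Frame.Y' (Φ : S.Frame) (p : M) : EuclideanSpace ℝ (Fin 3) → EuclideanSpace ℝ (Fin 3) :=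
  vecInChart p fun q => (S.J q (Φ.X q) : TangentSpace (𝓡 3) q)

/-- In coordinates, the contact planes of a contact form have the smooth frame `X, J X`. -/
lemma IsContactForm.isContact (hθ : S.IsContactForm θ) (Φ : S.Frame) (p : M) :
    IsContact (chartSet p Φ.U) (Φ.X' p) (Φ.Y' p) (θ.inChart p) where
  isOpen := isOpen_chartSet p Φ.isOpen_U
  X_smooth y hy := contDiffAt_vectorField Φ.isOpen_U Φ.smooth hy.1 hy.2
  Y_smooth y hy := contDiffAt_vectorField Φ.isOpen_U Φ.smooth_J hy.1 hy.2
  smooth y hy := hθ.smooth.contDiffAt' hy.1 trivial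
  X_mem y hy := (inChart_chartDeriv_symm θ hy.1 _).trans ((hθ.ker_eq _ _).1 (Φ.X _).2)
  Y_mem y hy := (inChart_chartDeriv_symm θ hy.1 _).trans ((hθ.ker_eq _ _).1 (S.J _ (Φ.X _)).2)
  span y hy v hv := by
    obtain ⟨a, b, h⟩ := S.exists_eq_smul_add_smul_J (Φ.ne_zero _ hy.2)
      ⟨chartSymmDeriv p y v, (hθ.ker_eq _ _).2 hv⟩
    refine ⟨a, b, ?_⟩
    have := congrArg (fun w : S.H _ => chartDeriv p ((extChartAt (𝓡 3) p).symm y)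
      (w : TangentSpace (𝓡 3) _)) h
    simp only [chartDeriv_chartSymmDeriv hy.1] at this
    rw [this]
    let q := (extChartAt (𝓡 3) p).symm y
    refine ((chartDeriv p q).map_add (a • (Φ.X q : TangentSpace (𝓡 3) q))
      (b • ((S.J q (Φ.X q) : S.H q) : TangentSpace (𝓡 3) q))).trans ?_
    rw [map_smul, map_smul]
    rfl
  pos y hy := by
    have := hθ.pos _ (Φ.X ((extChartAt (𝓡 3) p).symm y)) (Φ.ne_zero _ hy.2)
    rwa [← extD_inChart_chartDeriv hy.1 (hθ.smooth.contDiffAt' hy.1 trivial)] at this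
  ne y hy := by
    obtain ⟨v, hv⟩ := S.exists_ne_zero hθ ((extChartAt (𝓡 3) p).symm y)
    exact ⟨chartDeriv p _ v, by rwa [inChart_chartDeriv_symm θ hy.1]⟩

variable (C : S.AdmissibleCoframe θ)

lemma AdmissibleCoframe.θ₁_J (hq : q ∈ C.U) (v : S.H q) :
    C.θ₁ q (S.J q v) = Complex.I * C.θ₁ q v := by
  have := C.θ₁_type q hq v
  rw [evalZbar] at this
  linear_combination (norm := (ring_nf; simp only [Complex.I_sq]; ring)) (-2 * Complex.I) * this

lemma AdmissibleCoframe.θ₁_X (hq : q ∈ C.U) : C.θ₁ q (C.X q) = 1 := by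
  have := C.θ₁_Z q hq
  rw [evalZ, C.θ₁_J hq] at this
  linear_combination (norm := (ring_nf; simp only [Complex.I_sq]; ring)) this

lemma AdmissibleCoframe.θ₁_ne_zero (hq : q ∈ C.U) {X : S.H q} (hX : X ≠ 0) : C.θ₁ q X ≠ 0 := by
  intro h
  obtain ⟨a, b, hab⟩ := S.exists_eq_smul_add_smul_J hX (C.X q)
  have := C.θ₁_X hq
  rw [hab] at this
  simp [C.θ₁_J hq, h] at this

lemma AdmissibleCoframe.h_ne_zero (hθ : S.IsContactForm θ) (hq : q ∈ C.U) : C.h q ≠ 0 := by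
  intro h
  have hX : C.X q ≠ 0 := by
    intro h0
    have := C.θ₁_X hq
    simp [h0] at this
  have := C.dθ_eq q hq (C.X q) (S.J q (C.X q))
  rw [h] at this
  simp only [Complex.ofReal_zero, mul_zero, zero_mul, Complex.ofReal_eq_zero] at this
  exact (hθ.pos q (C.X q) hX).ne' this

/-- An admissible coframe in coordinates. -/
lemma AdmissibleCoframe.isCoframe (hθ : S.IsContactForm θ) (Φ : S.Frame) (p : M) :
    IsCoframe (chartSet p (Φ.U ∩ C.U)) (Φ.X' p) (Φ.Y' p) (θ.inChart p) (C.θ₁.inChart p)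
      (C.conn.inChart p) (fun y => C.h ((extChartAt (𝓡 3) p).symm y))
      (fun y => C.R ((extChartAt (𝓡 3) p).symm y))
      (fun y => C.A ((extChartAt (𝓡 3) p).symm y)) where
  θ₁_smooth y hy := C.θ₁_smooth.contDiffAt' hy.1 hy.2.2
  κ_smooth y hy := C.conn_smooth.contDiffAt' hy.1 hy.2.2
  h_smooth y hy := contDiffAt_comp_symm hy.1 (C.h_smooth.contMDiffAt (C.isOpen_U.mem_nhds hy.2.2))
  R_smooth y hy := contDiffAt_comp_symm hy.1 (C.R_smooth.contMDiffAt (C.isOpen_U.mem_nhds hy.2.2))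
  A_smooth y hy := contDiffAt_comp_symm hy.1 (C.A_smooth.contMDiffAt (C.isOpen_U.mem_nhds hy.2.2))
  type y hy := by
    simp only [Frame.X', Frame.Y', vecInChart, inChart_chartDeriv_symm C.θ₁ hy.1]
    exact C.θ₁_J hy.2.2 _
  ne y hy := by
    simp only [Frame.X', vecInChart, inChart_chartDeriv_symm C.θ₁ hy.1]
    exact C.θ₁_ne_zero hy.2.2 (Φ.ne_zero _ hy.2.1)
  h_ne y hy := C.h_ne_zero hθ hy.2.2
  dθ_eq y hy v w := by
    rw [extD_inChart hy.1 (hθ.smooth.contDiffAt' hy.1 trivial)]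
    exact C.dθ_eq _ hy.2.2 _ _
  dθ₁_eq y hy v w := by
    rw [extD_inChart hy.1 (C.θ₁_smooth.contDiffAt' hy.1 hy.2.2)]
    exact C.dθ₁_eq _ hy.2.2 _ _
  dh_eq y hy v := by
    rw [fderiv_comp_symm hy.1 (C.h_smooth.contMDiffAt (C.isOpen_U.mem_nhds hy.2.2))]
    exact C.dh_eq _ hy.2.2 _
  dκ_eq y hy := by
    simp only [Frame.X', Frame.Y', vecInChart, LocalForm.wedge, bar_apply,
      extD_inChart_chartDeriv hy.1 (C.conn_smooth.contDiffAt' hy.1 hy.2.2),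
      inChart_chartDeriv_symm C.θ₁ hy.1]
    exact C.dconn_eq _ hy.2.2 _ _

/-- The pseudo-Einstein condition at a point in coordinates. -/
lemma AdmissibleCoframe.W_eq_zero_iff (hθ : S.IsContactForm θ) (Φ : S.Frame)
    (hy : y ∈ chartSet p (Φ.U ∩ C.U)) :
    C.W ((extChartAt (𝓡 3) p).symm y) = 0 ↔ ∀ v w, extD (eta (C.conn.inChart p)
      (fun y => C.R ((extChartAt (𝓡 3) p).symm y)) (θ.inChart p)) y v w = 0 := by
  have hs : chartSet p (Φ.U ∩ C.U) ⊆ chartSet p Φ.U := fun z hz => ⟨hz.1, hz.2.1⟩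
  have hc := (hθ.isContact Φ p).mono (isOpen_chartSet p (Φ.isOpen_U.inter C.isOpen_U)) hs
  set q := (extChartAt (𝓡 3) p).symm y with hq
  have hX (v : S.H q) : θ.inChart p y (chartDeriv p q (v : TangentSpace (𝓡 3) q)) = 0 := by
    rw [inChart_chartDeriv_symm θ hy.1]
    exact (hθ.ker_eq q v).1 v.2
  -- The field `C.X` is not assumed smooth. It enters only through its value at q, while Φ supplies
  -- the smooth frame.
  rw [← (C.isCoframe hθ Φ p).compW_eq_zero_iff hc hy (hX (C.X q)) (hX (S.J q (C.X q)))
    (by rw [inChart_chartDeriv_symm C.θ₁ hy.1, C.θ₁_X hy.2.2])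
    (by rw [inChart_chartDeriv_symm C.θ₁ hy.1, C.θ₁_J hy.2.2, C.θ₁_X hy.2.2, mul_one])]
  have e {F : Type} [NormedAddCommGroup F] [NormedSpace ℝ F] {f : M → F}
      (hf : ContMDiffOn (𝓡 3) 𝓘(ℝ, F) ∞ f C.U) (v : TangentSpace (𝓡 3) q) :
      fderiv ℝ (fun y => f ((extChartAt (𝓡 3) p).symm y)) y (chartDeriv p q v) =
        oneFormOf f q v := by
    rw [fderiv_comp_symm hy.1 (hf.contMDiffAt (C.isOpen_U.mem_nhds hy.2.2)),
      chartSymmDeriv_chartDeriv hy.1]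
  have e' (v : TangentSpace (𝓡 3) q) : C.conn.inChart p y (chartDeriv p q v) = C.conn q v :=
    inChart_chartDeriv_symm C.conn hy.1 v
  refine Eq.congr ?_ rfl
  simp only [compW, e C.R_smooth, e C.A_smooth, e']
  rfl

end CRStructure

/-! ### The conformal factor between two contact forms, in coordinates. -/

namespace LocalForm

open Filter Topology

variable {E : Type*} [NormedAddCommGroup E] [NormedSpace ℝ E]
  {Ω : Set E} {X Y : E → E} {θ θ' : E → E →L[ℝ] ℝ} {x : E}

/-- Two contact forms with the same oriented contact planes differ by a positive factor. -/
lemma IsContact.exists_conformal (hc : IsContact Ω X Y θ) (hc' : IsContact Ω X Y θ') (hx : x ∈ Ω) :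
    ∃ g : E → ℝ, ContDiffAt ℝ ∞ g x ∧ 0 < g x ∧ ∀ᶠ y in 𝓝 x, θ' y = g y • θ y := by
  obtain ⟨Ω', hs, ho, hx', e, he⟩ := hc.exists_transverse hx
  let g : E → ℝ := fun y => (θ y e)⁻¹ * θ' y e
  have hg : ContDiffAt ℝ ∞ g x := (((hc.smooth x hx).clm_apply contDiffAt_const).inv (he x hx')).mul
    ((hc'.smooth x hx).clm_apply contDiffAt_const)
  have ev : ∀ᶠ y in 𝓝 x, θ' y = g y • θ y := by
    filter_upwards [ho.mem_nhds hx'] with y hy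
    refine hc.clm_ext (hs hy) (he y hy) ?_ ?_ ?_
    · simp [hc.X_mem y (hs hy), hc'.X_mem y (hs hy)]
    · simp [hc.Y_mem y (hs hy), hc'.Y_mem y (hs hy)]
    · have := he y hy
      simp [g]
      field_simp
  refine ⟨g, hg, ?_, ev⟩
  -- On (X, Y) the term dg ∧ θ vanishes, so dθ' = g dθ there with both sides positive, which forces
  -- g > 0.
  have h1 := hc.pos x hx
  have h2 := hc'.pos x hx
  rw [extD_congr ev, extD_smul (hg.differentiableAt (by simp))
    ((hc.smooth x hx).differentiableAt (by simp)), hc.X_mem x hx, hc.Y_mem x hx] at h2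
  simp only [mul_zero, sub_zero, add_zero] at h2
  exact (mul_pos_iff_of_pos_right h1).1 h2

end LocalForm

/-! ### Existence of coframes and of the conformal factor on the manifold. -/

namespace CRStructure

open Filter Topology LocalForm OneForm

variable {M : Type*} [TopologicalSpace M] [ChartedSpace (EuclideanSpace ℝ (Fin 3)) M]
  [IsManifold (𝓡 3) ∞ M] {S : CRStructure M} {θ θ' : OneForm M ℝ} {p q : M}
  {y : EuclideanSpace ℝ (Fin 3)}

/-- Each plane of H is a complex line for J, so complex linearity need only be checked on one
nonzero vector. -/
lemma apply_J_of_apply_J (L : TangentSpace (𝓡 3) q →L[ℝ] ℂ) {X : S.H q} (hX : X ≠ 0)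
    (h : L (S.J q X) = Complex.I * L X) (v : S.H q) : L (S.J q v) = Complex.I * L v := by
  obtain ⟨a, b, rfl⟩ := S.exists_eq_smul_add_smul_J hX v
  have key (a b : ℝ) (v w : S.H q) : L ((a • v + b • w : S.H q) : TangentSpace (𝓡 3) q) =
      a * L v + b * L w := by
    refine (L.map_add (a • (v : TangentSpace (𝓡 3) q)) (b • (w : TangentSpace (𝓡 3) q))).trans ?_
    rw [map_smul, map_smul, Complex.real_smul, Complex.real_smul]
  rw [map_add, map_smul, map_smul, S.J_sq, smul_neg, ← neg_smul, key, key, h]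
  push_cast
  linear_combination (-b * L X) * Complex.I_sq

lemma oneFormOf_comp_extChartAt {F : Type*} [NormedAddCommGroup F] [NormedSpace ℝ F]
    {g : EuclideanSpace ℝ (Fin 3) → F} (hq : q ∈ (extChartAt (𝓡 3) p).source)
    (hg : ContDiffAt ℝ ∞ g (extChartAt (𝓡 3) p q)) (v : TangentSpace (𝓡 3) q) :
    oneFormOf (fun q => g (extChartAt (𝓡 3) p q)) q v =
      fderiv ℝ g (extChartAt (𝓡 3) p q) (chartDeriv p q v) := by
  have h1 : MDifferentiableAt (𝓡 3) 𝓘(ℝ, EuclideanSpace ℝ (Fin 3)) (extChartAt (𝓡 3) p) q :=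
    mdifferentiableAt_extChartAt (by simpa using hq)
  have := mfderiv_comp q (hg.differentiableAt (by simp)).mdifferentiableAt h1
  rw [mfderiv_eq_fderiv] at this
  exact congrArg (fun L => L v) this

/-- Admissible coframes exist near every point. -/
lemma IsContactForm.exists_admissibleCoframe (hθ : S.IsContactForm θ) (p : M) :
    ∃ C : S.AdmissibleCoframe θ, p ∈ C.U := by
  obtain ⟨Φ, hp⟩ := S.exists_frame p
  have hc := hθ.isContact Φ p
  obtain ⟨Ω, hs, ho, hx, θ₁, κ, h, R, A, hC⟩ :=
    hc.exists_isCoframe (mem_chartSet (mem_extChartAt_source p) hp)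
  let U : Set M := (extChartAt (𝓡 3) p).source ∩ extChartAt (𝓡 3) p ⁻¹' Ω
  have hΦ {q} (hq : q ∈ U) : q ∈ Φ.U := by
    have := (hs hq.2).2
    rwa [Set.mem_preimage, (extChartAt (𝓡 3) p).left_inv hq.1] at this
  have hX {q} (hq : q ∈ U) : Φ.X' p (extChartAt (𝓡 3) p q) = chartDeriv p q (Φ.X q) :=
    vecInChart_extChartAt hq.1 _
  have hY {q} (hq : q ∈ U) : Φ.Y' p (extChartAt (𝓡 3) p q) = chartDeriv p q (S.J q (Φ.X q)) :=
    vecInChart_extChartAt hq.1 _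
  have hJ {q} (hq : q ∈ U) (v : S.H q) :
      pull p θ₁ q (S.J q v) = Complex.I * pull p θ₁ q v := by
    refine apply_J_of_apply_J _ (Φ.ne_zero q (hΦ hq)) ?_ v
    rw [pull_apply, pull_apply, ← hX hq, ← hY hq, hC.type _ hq.2]
  have hd {q} (hq : q ∈ U) (v w : TangentSpace (𝓡 3) q) : θ.d q v w =
      extD (θ.inChart p) (extChartAt (𝓡 3) p q) (chartDeriv p q v) (chartDeriv p q w) :=
    d_eq_extD hq.1 (hθ.smooth.contDiffAt trivial hq.1) v w
  have hdec {q} (hq : q ∈ U) (v : S.H q) : ∃ a b : ℝ, chartDeriv p q v =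
      a • Φ.X' p (extChartAt (𝓡 3) p q) + b • Φ.Y' p (extChartAt (𝓡 3) p q) := by
    refine hc.span _ (hs hq.2) _ ?_
    rw [inChart_chartDeriv θ hq.1]
    exact (hθ.ker_eq q v).1 v.2
  -- Multiplying the frame vector by the complex number 1/θ¹(X), acting through J, gives the vector
  -- dual to θ¹.
  let c : M → ℂ := fun q => (pull p θ₁ q (Φ.X q))⁻¹
  refine ⟨{
    U := U
    isOpen_U := (continuousOn_extChartAt p).isOpen_inter_preimage (isOpen_extChartAt_source p) ho
    θ₁ := pull p θ₁
    θ₁_smooth := smoothOn_pull Set.inter_subset_left fun q hq => hC.θ₁_smooth _ hq.2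
    θ₁_type := fun q hq v => by
      rw [evalZbar, hJ hq]
      linear_combination (pull p θ₁ q v / 2) * Complex.I_sq
    θ₁_reeb := fun q hq v hv => by
      rw [pull_apply]
      refine hC.θ₁_reeb hq.2 ?_ ?_
      · rw [hX hq, ← hd hq]
        exact hv.2 _
      · rw [hY hq, ← hd hq]
        exact hv.2 _
    X := fun q => (c q).re • Φ.X q + (c q).im • S.J q (Φ.X q)
    θ₁_Z := fun q hq => by
      have hne : pull p θ₁ q (Φ.X q) ≠ 0 := by
        rw [pull_apply, ← hX hq]
        exact hC.ne _ hq.2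
      have h1 : pull p θ₁ q (((c q).re • Φ.X q + (c q).im • S.J q (Φ.X q) : S.H q) :
          TangentSpace (𝓡 3) q) = 1 := by
        refine ((pull p θ₁ q).map_add ((c q).re • (Φ.X q : TangentSpace (𝓡 3) q))
          ((c q).im • ((S.J q (Φ.X q) : S.H q) : TangentSpace (𝓡 3) q))).trans ?_
        rw [map_smul, map_smul, hJ hq, Complex.real_smul, Complex.real_smul]
        calc _ = ((c q).re + (c q).im * Complex.I) * pull p θ₁ q (Φ.X q) := by ring
          _ = 1 := by rw [Complex.re_add_im, inv_mul_cancel₀ hne]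
      rw [evalZ, hJ hq, h1]
      linear_combination (-1 / 2) * Complex.I_sq
    h := fun q => h (extChartAt (𝓡 3) p q)
    h_smooth := fun q hq =>
      (contMDiffAt_comp_extChartAt hq.1 (hC.h_smooth _ hq.2)).contMDiffWithinAt
    dθ_eq := fun q hq v w => by
      rw [hd hq]
      exact hC.dθ_eq _ hq.2 _ _
    conn := pull p κ
    conn_smooth := smoothOn_pull Set.inter_subset_left fun q hq => hC.κ_smooth _ hq.2
    A := fun q => A (extChartAt (𝓡 3) p q)
    A_smooth := fun q hq =>
      (contMDiffAt_comp_extChartAt hq.1 (hC.A_smooth _ hq.2)).contMDiffWithinAt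
    dθ₁_eq := fun q hq v w => by
      rw [d_pull hq.1 (hC.θ₁_smooth _ hq.2)]
      have := hC.dθ₁_eq _ hq.2 (chartDeriv p q v) (chartDeriv p q w)
      simp only [LocalForm.wedge, toC_apply, inChart_chartDeriv θ hq.1] at this
      exact this
    dh_eq := fun q hq v => by
      rw [oneFormOf_comp_extChartAt hq.1 (hC.h_smooth _ hq.2)]
      exact hC.dh_eq _ hq.2 _
    R := fun q => R (extChartAt (𝓡 3) p q)
    R_smooth := fun q hq =>
      (contMDiffAt_comp_extChartAt hq.1 (hC.R_smooth _ hq.2)).contMDiffWithinAt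
    dconn_eq := fun q hq v w => by
      rw [d_pull hq.1 (hC.κ_smooth _ hq.2)]
      change _ = _ * LocalForm.wedge θ₁ (LocalForm.bar θ₁) (extChartAt (𝓡 3) p q)
        (chartDeriv p q v) (chartDeriv p q w)
      -- Both sides are alternating on a plane, so the equation on the frame implies it in general:
      -- each side scales by the determinant.
      obtain ⟨a, b, hv⟩ := hdec hq v
      obtain ⟨a', b', hw⟩ := hdec hq w
      rw [hv, hw, extD_expand₂, hC.dκ_eq _ hq.2]
      simp only [LocalForm.wedge, bar_apply, map_add, map_smul, Complex.real_smul]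
      push_cast
      ring }, mem_extChartAt_source p, hx⟩

omit [IsManifold (𝓡 3) ∞ M] in
lemma inChart_exp_smul (θ : OneForm M ℝ) (u : M → ℝ) (p : M) :
    OneForm.inChart (fun q => Real.exp (u q) • θ q) p =
      fun y => Real.exp (u ((extChartAt (𝓡 3) p).symm y)) • θ.inChart p y := rfl

lemma IsContactForm.exp_smul (hθ : S.IsContactForm θ) {u : M → ℝ}
    (hu : ContMDiff (𝓡 3) 𝓘(ℝ, ℝ) ∞ u) : S.IsContactForm (fun p => Real.exp (u p) • θ p) where
  smooth p _ := by
    have hy := mem_extChartAt_target (I := 𝓡 3) p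
    rw [inChart_exp_smul]
    exact (contDiffAt_comp_symm hy hu.contMDiffAt).exp.smul (hθ.smooth.contDiffAt' hy trivial)
  ker_eq p v := by
    rw [hθ.ker_eq]
    change _ ↔ Real.exp (u p) * θ p v = 0
    simp [Real.exp_ne_zero]
  pos p v hv := by
    have hy := mem_extChartAt_target (I := 𝓡 3) p
    have hs := mem_extChartAt_source (I := 𝓡 3) p
    have key := extD_exp_smul (contDiffAt_comp_symm hy hu.contMDiffAt)
      (hθ.smooth.contDiffAt' hy trivial) (chartDeriv p p v) (chartDeriv p p (S.J p v))
    rw [inChart_chartDeriv θ hs, inChart_chartDeriv θ hs, (hθ.ker_eq p v).1 v.2,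
      (hθ.ker_eq p _).1 (S.J p v).2, mul_zero, mul_zero, sub_zero, add_zero] at key
    refine lt_of_lt_of_eq ?_ key.symm
    exact mul_pos (Real.exp_pos _) (hθ.pos p v hv)

/-- Two contact forms differ by a positive smooth factor. -/
lemma IsContactForm.exists_eq_exp_smul (hθ : S.IsContactForm θ) (hθ' : S.IsContactForm θ') :
    ∃ u : M → ℝ, ContMDiff (𝓡 3) 𝓘(ℝ, ℝ) ∞ u ∧ θ' = fun p => Real.exp (u p) • θ p := by
  have key (p : M) : ∃ g : EuclideanSpace ℝ (Fin 3) → ℝ,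
      ContDiffAt ℝ ∞ g (extChartAt (𝓡 3) p p) ∧ 0 < g (extChartAt (𝓡 3) p p) ∧
      ∀ᶠ q in 𝓝 p, ∀ v, θ' q v = g (extChartAt (𝓡 3) p q) * θ q v := by
    obtain ⟨Φ, hp⟩ := S.exists_frame p
    obtain ⟨g, hg, hpos, ev⟩ := (hθ.isContact Φ p).exists_conformal (hθ'.isContact Φ p)
      (mem_chartSet (mem_extChartAt_source p) hp)
    refine ⟨g, hg, hpos, ?_⟩
    filter_upwards [(continuousAt_extChartAt p).eventually ev,
      extChartAt_source_mem_nhds (I := 𝓡 3) p] with q hq hs v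
    rw [← inChart_chartDeriv θ' hs, ← inChart_chartDeriv θ hs, hq]
    rfl
  choose g hg hpos ev using key
  -- The local factors need not be glued: c takes each one at its own base point. As θ is nowhere
  -- zero, the factor is unique, so c agrees with the smooth local one near p.
  let c : M → ℝ := fun p => g p (extChartAt (𝓡 3) p p)
  have hc (p : M) v : θ' p v = c p * θ p v := (ev p).self_of_nhds v
  refine ⟨fun p => Real.log (c p), fun p => ?_, ?_⟩
  · have s := contMDiffAt_comp_extChartAt (mem_extChartAt_source p)
      ((hg p).log (hpos p).ne')
    refine s.congr_of_eventuallyEq ?_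
    filter_upwards [ev p] with q hq
    obtain ⟨v, hv⟩ := S.exists_ne_zero hθ q
    have : c q = g p (extChartAt (𝓡 3) p q) := mul_right_cancel₀ hv ((hc q v).symm.trans (hq v))
    rw [this]
  · funext p
    ext v
    rw [hc p v, Real.exp_log (hpos p)]
    rfl

end CRStructure

/-! ### The two inclusions. -/

namespace CRStructure

open Filter Topology LocalForm OneForm

variable {M : Type*} [TopologicalSpace M] [ChartedSpace (EuclideanSpace ℝ (Fin 3)) M]
  [IsManifold (𝓡 3) ∞ M] {S : CRStructure M} {θ : OneForm M ℝ} {u : M → ℝ}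

/-- If `θ` and `e^u θ` are pseudo-Einstein, then `u` is CR pluriharmonic. -/
lemma IsPseudoEinstein.isCRPluriharmonic (hθ : S.IsPseudoEinstein θ)
    (hu : ContMDiff (𝓡 3) 𝓘(ℝ, ℝ) ∞ u)
    (hθ' : S.IsPseudoEinstein (fun p => Real.exp (u p) • θ p)) : S.IsCRPluriharmonic u := by
  refine ⟨hu, fun p => ?_⟩
  obtain ⟨Φ, hΦ⟩ := S.exists_frame p
  obtain ⟨C, hC⟩ := hθ.1.exists_admissibleCoframe p
  obtain ⟨C', hC'⟩ := hθ'.1.exists_admissibleCoframe p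
  have hΩ : chartSet p (Φ.U ∩ (C.U ∩ C'.U)) ⊆ chartSet p Φ.U := fun y hy => ⟨hy.1, hy.2.1⟩
  have h1 : chartSet p (Φ.U ∩ (C.U ∩ C'.U)) ⊆ chartSet p (Φ.U ∩ C.U) :=
    fun y hy => ⟨hy.1, hy.2.1, hy.2.2.1⟩
  have h2 : chartSet p (Φ.U ∩ (C.U ∩ C'.U)) ⊆ chartSet p (Φ.U ∩ C'.U) :=
    fun y hy => ⟨hy.1, hy.2.1, hy.2.2.2⟩
  have ho := isOpen_chartSet p (Φ.isOpen_U.inter (C.isOpen_U.inter C'.isOpen_U))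
  obtain ⟨Ω, hs, hΩo, hx, F, hF⟩ := ((C.isCoframe hθ.1 Φ p).mono h1).exists_isCR
    ((hθ.1.isContact Φ p).mono ho hΩ) ((C'.isCoframe hθ'.1 Φ p).mono h2)
    (fun y hy => contDiffAt_comp_symm hy.1 hu.contMDiffAt)
    (fun y hy => (C.W_eq_zero_iff hθ.1 Φ (h1 hy)).1 (hθ.2 C _ hy.2.2.1))
    (fun y hy => (C'.W_eq_zero_iff hθ'.1 Φ (h2 hy)).1 (hθ'.2 C' _ hy.2.2.2))
    (mem_chartSet (mem_extChartAt_source p) ⟨hΦ, hC, hC'⟩)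
  refine ⟨(extChartAt (𝓡 3) p).source ∩ extChartAt (𝓡 3) p ⁻¹' Ω,
    (continuousOn_extChartAt p).isOpen_inter_preimage (isOpen_extChartAt_source p) hΩo,
    ⟨mem_extChartAt_source p, hx⟩, fun q => F (extChartAt (𝓡 3) p q),
    ⟨fun q hq => (contMDiffAt_comp_extChartAt hq.1 (hF _ hq.2).1).contMDiffWithinAt,
      fun q hq v => ?_⟩, fun q hq => ?_⟩
  · have hqΦ : q ∈ Φ.U := by
      have := (hs hq.2).2.1
      rwa [(extChartAt (𝓡 3) p).left_inv hq.1] at this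
    have hX : Φ.X' p (extChartAt (𝓡 3) p q) = chartDeriv p q (Φ.X q) :=
      vecInChart_extChartAt hq.1 _
    have hY : Φ.Y' p (extChartAt (𝓡 3) p q) = chartDeriv p q (S.J q (Φ.X q)) :=
      vecInChart_extChartAt hq.1 _
    have key := (hF _ hq.2).2.1
    rw [hX, hY, ← oneFormOf_comp_extChartAt hq.1 (hF _ hq.2).1,
      ← oneFormOf_comp_extChartAt hq.1 (hF _ hq.2).1] at key
    -- The CR equation is known on the frame vector only; in the form dF(JX) = i dF(X) it extends to
    -- all of H.
    rw [evalZbar, apply_J_of_apply_J _ (Φ.ne_zero q hqΦ)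
      (by linear_combination (-Complex.I) * key +
        oneFormOf (fun q => F (extChartAt (𝓡 3) p q)) q (S.J q (Φ.X q)) * Complex.I_sq)]
    linear_combination
      (oneFormOf (fun q => F (extChartAt (𝓡 3) p q)) q v / 2) * Complex.I_sq
  · have := (hF _ hq.2).2.2
    rwa [(extChartAt (𝓡 3) p).left_inv hq.1] at this

/-- If `θ` is pseudo-Einstein and `u` is CR pluriharmonic, then `e^u θ` is pseudo-Einstein. -/
lemma IsPseudoEinstein.exp_smul (hθ : S.IsPseudoEinstein θ) (hu : S.IsCRPluriharmonic u) :
    S.IsPseudoEinstein (fun p => Real.exp (u p) • θ p) := by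
  have hθ' := hθ.1.exp_smul hu.1
  refine ⟨hθ', fun C' p hC' => ?_⟩
  obtain ⟨Φ, hΦ⟩ := S.exists_frame p
  -- The coframe C' is arbitrary. The hypothesis on θ becomes usable only through a coframe of θ
  -- near p, whose form η is then closed.
  obtain ⟨C, hC⟩ := hθ.1.exists_admissibleCoframe p
  obtain ⟨U, hU, hpU, f, hf, hre⟩ := hu.2 p
  let V := Φ.U ∩ (C.U ∩ (C'.U ∩ U))
  have h0 : chartSet p V ⊆ chartSet p Φ.U := fun y hy => ⟨hy.1, hy.2.1⟩
  have h1 : chartSet p V ⊆ chartSet p (Φ.U ∩ C.U) := fun y hy => ⟨hy.1, hy.2.1, hy.2.2.1⟩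
  have h2 : chartSet p V ⊆ chartSet p (Φ.U ∩ C'.U) := fun y hy => ⟨hy.1, hy.2.1, hy.2.2.2.1⟩
  have ho : IsOpen (chartSet p V) :=
    isOpen_chartSet p (Φ.isOpen_U.inter (C.isOpen_U.inter (C'.isOpen_U.inter hU)))
  have hp : extChartAt (𝓡 3) p p ∈ chartSet p V :=
    mem_chartSet (mem_extChartAt_source p) ⟨hΦ, hC, hC', hpU⟩
  have key := ((C.isCoframe hθ.1 Φ p).mono h1).closed_of_isCR ((hθ.1.isContact Φ p).mono ho h0)
    ((C'.isCoframe hθ' Φ p).mono h2) (fun y hy => contDiffAt_comp_symm hy.1 hu.1.contMDiffAt)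
    (fun y hy => (C.W_eq_zero_iff hθ.1 Φ (h1 hy)).1 (hθ.2 C _ hy.2.2.1))
    (F := fun y => f ((extChartAt (𝓡 3) p).symm y)) (fun y hy => by
      have hfy := hf.1.contMDiffAt (hU.mem_nhds hy.2.2.2.2)
      refine ⟨contDiffAt_comp_symm hy.1 hfy, ?_, hre _ hy.2.2.2.2⟩
      have h := hf.2 _ hy.2.2.2.2 (Φ.X _)
      rw [fderiv_comp_symm hy.1 hfy, fderiv_comp_symm hy.1 hfy]
      simp only [Frame.X', Frame.Y', vecInChart, chartSymmDeriv_chartDeriv hy.1]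
      rw [evalZbar] at h
      linear_combination 2 * h) hp
  have := (C'.W_eq_zero_iff hθ' Φ (h2 hp)).2 key
  rwa [extChartAt_to_inv] at this

end CRStructure

theorem mainTheorem7 {M : Type*} [TopologicalSpace M] [T2Space M] [SecondCountableTopology M]
    [ChartedSpace (EuclideanSpace ℝ (Fin 3)) M] [IsManifold (𝓡 3) ∞ M]
    (S : CRStructure M) (θ : OneForm M ℝ) (hθ : S.IsPseudoEinstein θ) :
    {θ' : OneForm M ℝ | S.IsPseudoEinstein θ'} =
      {θ' : OneForm M ℝ | ∃ u : M → ℝ, S.IsCRPluriharmonic u ∧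
        θ' = fun p => Real.exp (u p) • θ p} := by
  ext θ'
  constructor
  · intro hθ'
    obtain ⟨u, hu, rfl⟩ := hθ.1.exists_eq_exp_smul hθ'.1
    exact ⟨u, hθ.isCRPluriharmonic hu hθ', rfl⟩
  · rintro ⟨u, hu, rfl⟩
    exact hθ.exp_smul hu
end
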